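/- **Notation.** For $\alpha,\beta>-1$ let $\mu_{\alpha,\beta}(dx)=\frac{\Gamma(\alpha+\beta+2)}{2^{\alpha+\beta+1}\Gamma(\alpha+1)\Gamma(\beta+1)}(1-x)^\alpha(1+x)^\beta\,dx$ on $(-1,1)$, let $\gamma(dx)=\pi^{-1/2}e^{-x^2}dx$ on $\mathbb R$, and let $\mu_\alpha(dx)=\frac{1}{\Gamma(\alpha+1)}x^\alpha e^{-x}dx$ on $(0,\infty)$. Let $P^{(\alpha,\beta)}_k$, $H_k$, $L^\alpha_k$ be the Jacobi, Hermite and Laguerre polynomials, orthogonal for $\mu_{\alpha,\beta}$, $\gamma$, $\mu_\alpha$ respectively, in Szegő's normalization ($P_k^{(\alpha,\beta)}(1)=\binom{k+\alpha}{k}$, $H_k$ has leading coefficient $2^k$, $L_k^\alpha(0)=\binom{k+\alpha}{k}$). For real-valued functions, the Jacobi–, Gaussian– and Laguerre–Riesz transforms are defined on $L^2(\mu_{\alpha,\beta})$, $L^2(\gamma)$, $L^2(\mu_\alpha)$ by the $L^2$-convergent series $$R^{\alpha,\beta}f=\sum_{k\ge1}\frac{\langle f,P^{(\alpha,\beta)}_k\rangle}{\|P^{(\alpha,\beta)}_k\|_2^2}\,\frac{1}{\sqrt{k(k+\alpha+\beta+1)}}\;\frac{k+\alpha+\beta+1}{2}\,\sqrt{1-x^2}\,P^{(\alpha+1,\beta+1)}_{k-1}(x),$$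 $$R^{\gamma}f=\sum_{k\ge1}\frac{\langle f,H_k\rangle}{\|H_k\|_2^2}\,\sqrt{2k}\,H_{k-1}(x),\qquad R^{\alpha}f=-\sum_{k\ge1}\frac{\langle f,L^\alpha_k\rangle}{\|L^\alpha_k\|_2^2}\,\frac{1}{\sqrt k}\,\sqrt{x}\,L^{\alpha+1}_{k-1}(x),$$ with inner products and norms taken in the respective $L^2$ space. An operator $R$ on $L^2(\mu)$ is called *bounded on $L^p(\mu)$ with constant $C$* if there is a linear map $T$ of $L^p(\mu)$ into itself with $\|Tf\|_{L^p(\mu)}\le C\|f\|_{L^p(\mu)}$ for all $f\in L^p(\mu)$ and $Tf=Rf$ for all $f\in L^2(\mu)\cap L^p(\mu)$. **Theorem 2.2.** Let $1<p<\infty$ and let $C_p$ be a constant. (i) If $R^{\lambda-1/2,\lambda-1/2}$ is bounded on $L^p(\mu_{\lambda-1/2,\lambda-1/2})$ with constant $C_p$ for arbitrarily large $\lambda$ (that is, for an unbounded-above set of real $\lambda$), then $R^\gamma$ is bounded on $L^p(\gamma)$ with constant $C_p$. (ii) Let $\alpha>-1$. If $R^{\alpha,\beta}$ is bounded on $L^p(\mu_{\alpha,\beta})$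 with constant $C_p$ for arbitrarily large $\beta$, then $R^\alpha$ is bounded on $L^p(\mu_\alpha)$ with constant $C_p$. In particular, if $R^{\alpha,\beta}$ is bounded on $L^p(\mu_{\alpha,\beta})$ with one constant $C_p$ for all the parameters, then both conclusions hold with the same $C_p$. -/

import Mathlib

open MeasureTheory ProbabilityTheory Filter Topology
open scoped ENNReal NNReal

noncomputable section

/-- The normalized Jacobi measure on `(-1, 1)`, with density
`Γ(α+β+2) / (2^(α+β+1) Γ(α+1) Γ(β+1)) * (1-x)^α (1+x)^β`. -/
def jacobiMeasure (α β : ℝ) : Measure ℝ :=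
  (volume.restrict (Set.Ioo (-1 : ℝ) 1)).withDensity fun x =>
    ENNReal.ofReal
      (Real.Gamma (α + β + 2) / (2 ^ (α + β + 1) * Real.Gamma (α + 1) * Real.Gamma (β + 1))
        * ((1 - x) ^ α * (1 + x) ^ β))

/-- The Gaussian measure with density `e^(-x²) / √π`, that is, of mean `0` and variance `1/2`. -/
def hermiteMeasure : Measure ℝ := gaussianReal 0 (1 / 2)

/-- The Gamma measure on `(0, ∞)` with density `x^α e^(-x) / Γ(α+1)`. -/
def laguerreMeasure (α : ℝ) : Measure ℝ := gammaMeasure (α + 1) 1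

/-- The Jacobi polynomial in the normalization `P_n^(α,β)(1) = (α+1)_n / n!`:
`P_n^(α,β)(x) = ∑_j C(n,j) / n! * (n+α+β+1)_j * (α+j+1)_(n-j) * ((x-1)/2)^j`,
where `(a)_j` is the rising factorial. -/
def jacobiP (α β : ℝ) (n : ℕ) (x : ℝ) : ℝ :=
  ∑ j ∈ Finset.range (n + 1),
    (n.choose j : ℝ) / (n.factorial : ℝ) * (ascPochhammer ℝ j).eval (n + α + β + 1)
      * (ascPochhammer ℝ (n - j)).eval (α + j + 1) * ((x - 1) / 2) ^ j

/-- The Hermite polynomial orthogonal for `e^(-x²)`, with leading coefficient `2^n`: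
`H_n(x) = 2^(n/2) He_n(√2 x)`, where `He_n` is Mathlib's monic `Polynomial.hermite n`. -/
def hermiteH (n : ℕ) (x : ℝ) : ℝ :=
  (√2) ^ n * Polynomial.aeval (√2 * x) (Polynomial.hermite n)

/-- The Laguerre polynomial
`L_n^α(x) = ∑_j (α+j+1)_(n-j) / (n-j)! * (-x)^j / j!`. -/
def laguerreL (α : ℝ) (n : ℕ) (x : ℝ) : ℝ :=
  ∑ j ∈ Finset.range (n + 1),
    (ascPochhammer ℝ (n - j)).eval (α + j + 1) / ((n - j).factorial : ℝ)
      * ((-x) ^ j / (j.factorial : ℝ))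

/-- The coefficient `⟨f, P⟩ / ‖P‖²` of `f` along `P` in `L²(μ)`. -/
def orthoCoeff (μ : Measure ℝ) (P f : ℝ → ℝ) : ℝ :=
  (∫ x, f x * P x ∂μ) / ∫ x, P x ^ 2 ∂μ

/-- The series `∑ u n` converges to `g` in `L²(μ)`. -/
def HasL2Sum (μ : Measure ℝ) (u : ℕ → ℝ → ℝ) (g : ℝ → ℝ) : Prop :=
  MemLp g 2 μ ∧
    Tendsto (fun N : ℕ => eLpNorm (fun x => g x - ∑ n ∈ Finset.range N, u n x) 2 μ)
      atTop (𝓝 0)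

/-- `g` is the Jacobi-Riesz transform of `f ∈ L²(μ_{α,β})`: in `L²(μ_{α,β})`,
`g = ∑_{k ≥ 1} ⟨f, P_k⟩ / ‖P_k‖² * (k(k+α+β+1))^(-1/2) * (k+α+β+1)/2 * √(1-x²) P_{k-1}^(α+1,β+1)`.
The summation index below is `n = k - 1`. -/
def IsJacobiRiesz (α β : ℝ) (f g : ℝ → ℝ) : Prop :=
  HasL2Sum (jacobiMeasure α β)
    (fun n x => orthoCoeff (jacobiMeasure α β) (jacobiP α β (n + 1)) f
      * (1 / √((n + 1) * ((n + 1) + α + β + 1)))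
      * (((n + 1) + α + β + 1) / 2)
      * (√(1 - x ^ 2) * jacobiP (α + 1) (β + 1) n x)) g

/-- `g` is the Gaussian-Riesz transform of `f ∈ L²(γ)`: in `L²(γ)`,
`g = ∑_{k ≥ 1} ⟨f, H_k⟩ / ‖H_k‖² * √(2k) * H_{k-1}`. -/
def IsGaussianRiesz (f g : ℝ → ℝ) : Prop :=
  HasL2Sum hermiteMeasure
    (fun n x => orthoCoeff hermiteMeasure (hermiteH (n + 1)) f
      * √(2 * (n + 1)) * hermiteH n x) g

/-- `g` is the Laguerre-Riesz transform of `f ∈ L²(μ_α)`: in `L²(μ_α)`,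
`g = - ∑_{k ≥ 1} ⟨f, L_k^α⟩ / ‖L_k^α‖² * k^(-1/2) * √x L_{k-1}^(α+1)`. -/
def IsLaguerreRiesz (α : ℝ) (f g : ℝ → ℝ) : Prop :=
  HasL2Sum (laguerreMeasure α)
    (fun n x => -(orthoCoeff (laguerreMeasure α) (laguerreL α (n + 1)) f
      * (1 / √(n + 1)) * (√x * laguerreL (α + 1) n x))) g

/-- The operator `f ↦ g` given on `L²(μ)` by the relation `R f g` is bounded on `L^p(μ)` with
constant `C`: a linear map `T` of `L^p(μ)` with `‖T f‖ ≤ C ‖f‖` for all `f ∈ L^p(μ)` agrees with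
it on `L²(μ) ∩ L^p(μ)`. -/
def BoundedOnLp (μ : Measure ℝ) (R : (ℝ → ℝ) → (ℝ → ℝ) → Prop) (p : ℝ≥0∞) (C : ℝ) : Prop :=
  ∃ T : Lp ℝ p μ →ₗ[ℝ] Lp ℝ p μ,
    (∀ f, ‖T f‖ ≤ C * ‖f‖) ∧
    ∀ (f : ℝ → ℝ) (hf : MemLp f p μ), MemLp f 2 μ → R f (T (hf.toLp f))

end

/-! All three Riesz transforms have one shape: they send an orthogonal polynomial `P_k` to
`ev_k^(-1/2) a^(1/2) P_k'`, where `P_k` is an eigenfunction of an operator `a ∂² + b ∂` with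
eigenvalue `-ev_k`. The Jacobi operators degenerate to the other two. Under `x = y/√λ` the
ultraspherical weight becomes a multiple of `(1 - y²/λ)^(λ-1/2)`, which tends to `e^(-y²)`. Under `x
= 1 - 2y/β` the Jacobi weight becomes a multiple of `y^α (1 - y/β)^β`, which tends to `y^α e^(-y)`.
The suitably normalized polynomials converge coefficientwise to the Hermite and Laguerre
polynomials, and their Riesz images converge pointwise, up to a global sign in the Laguerre case,
where the rescaling reverses orientation.

Fix a finite linear combination of the limit polynomials and take the corresponding combinations
before the limit. The normalizing constants of the measures cancel from the `L^p` inequality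
(`HasWeight.eLpNorm_le_iff`). Dominated convergence for the functions and Fatou's lemma for their
Riesz images then preserve the inequality with the same constant (`lintegral_le_of_tendsto`,
`eLpNorm_rieszComb_le_of_tendsto`).

It remains to pass from polynomials to all of `L^p` (`RieszSystem.boundedOnLp`). Exponential moments
make the polynomials dense in every `L^r`, `1 ≤ r < ∞`, of the Gaussian and Gamma measures, so the
transform extends by continuity both from `L^p` and from `L²`; on `L²` it is a contraction, by the
orthogonality of the derivatives in `L²(a μ)` (`RieszSystem.of_eigenfunctions`). For `f` in both
spaces, approximation in `L^max(p,2)` exhibits the two extensions as limits in measure of one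
sequence, so they agree. -/

open Polynomial

/-! ### Riesz transforms of abstract orthogonal polynomial systems -/

/-- The function `a^(1/2) P_k' / ev_k^(1/2)`, the image of `P_k` under the Riesz transform of the
operator `a ∂² + b ∂` with eigenfunctions `P_k` and eigenvalues `-ev_k`. -/
noncomputable def rieszFun (a : ℝ[X]) (ev : ℕ → ℝ) (P : ℕ → ℝ[X]) (k : ℕ) (x : ℝ) : ℝ :=
  1 / √(ev k) * (√(a.eval x) * (derivative (P k)).eval x)

/-- `g` is the `L²` sum of the Riesz series of `f` with respect to the system `P`. -/
def IsRiesz (μ : Measure ℝ) (a : ℝ[X]) (ev : ℕ → ℝ) (P : ℕ → ℝ[X]) (f g : ℝ → ℝ) : Prop :=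
  HasL2Sum μ (fun n x => orthoCoeff μ (fun y => (P (n + 1)).eval y) f * rieszFun a ev P (n + 1) x) g

/-- A sequence of polynomials orthogonal in `L²(μ)` whose derivatives are orthogonal in `L²(a μ)`. -/
structure RieszSystem (μ : Measure ℝ) (a : ℝ[X]) (ev : ℕ → ℝ) (P : ℕ → ℝ[X]) : Prop where
  memLp : ∀ (q : ℝ[X]) (r : ℝ≥0∞), r ≠ ∞ → MemLp (fun x => q.eval x) r μ
  nonneg : ∀ᵐ x ∂μ, 0 ≤ a.eval x
  ev_pos : ∀ n, 0 < ev (n + 1)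
  derivative_zero : derivative (P 0) = 0
  orth : ∀ m n, m ≠ n → ∫ x, (P m).eval x * (P n).eval x ∂μ = 0
  deriv_inner : ∀ m n, ∫ x, a.eval x * (derivative (P m)).eval x * (derivative (P n)).eval x ∂μ
    = ev n * ∫ x, (P m).eval x * (P n).eval x ∂μ
  norm_pos : ∀ n, 0 < ∫ x, (P n).eval x ^ 2 ∂μ

/-- Finite linear combinations of the polynomials `P_k`, as functions. -/
noncomputable def polyComb (P : ℕ → ℝ[X]) : (ℕ →₀ ℝ) →ₗ[ℝ] (ℝ → ℝ) :=
  Finsupp.linearCombination ℝ fun k x => (P k).eval x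

/-- Finite linear combinations of the functions `rieszFun a ev P k`. -/
noncomputable def rieszComb (a : ℝ[X]) (ev : ℕ → ℝ) (P : ℕ → ℝ[X]) : (ℕ →₀ ℝ) →ₗ[ℝ] (ℝ → ℝ) :=
  Finsupp.linearCombination ℝ (rieszFun a ev P)

lemma polyComb_eq_eval (P : ℕ → ℝ[X]) (c : ℕ →₀ ℝ) (x : ℝ) :
    polyComb P c x = (Finsupp.linearCombination ℝ P c).eval x := by
  simp [polyComb, Finsupp.linearCombination_apply, Finsupp.sum, Finset.sum_apply,
    Polynomial.eval_finsetSum]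

lemma rieszComb_apply (a : ℝ[X]) (ev : ℕ → ℝ) (P : ℕ → ℝ[X]) (c : ℕ →₀ ℝ) (x : ℝ) :
    rieszComb a ev P c x = ∑ k ∈ c.support, c k * rieszFun a ev P k x := by
  simp [rieszComb, Finsupp.linearCombination_apply, Finsupp.sum, Finset.sum_apply]

/-- A linear map into functions, all of whose values lie in `L^r`, as a linear map into `L^r`. -/
noncomputable def linearToLp {V : Type*} [AddCommGroup V] [Module ℝ V] {μ : Measure ℝ} {r : ℝ≥0∞}
    (L : V →ₗ[ℝ] (ℝ → ℝ)) (h : ∀ v, MemLp (L v) r μ) : V →ₗ[ℝ] Lp ℝ r μ where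
  toFun v := (h v).toLp (L v)
  map_add' u v := by
    rw [← MemLp.toLp_add]; congr 1; simp
  map_smul' t v := by
    rw [RingHom.id_apply, ← MemLp.toLp_const_smul]; congr 1; simp

lemma norm_sq_linearCombination_of_orthogonal {E : Type*} [NormedAddCommGroup E]
    [InnerProductSpace ℝ E] (v : ℕ → E) (hv : ∀ m n, m ≠ n → inner ℝ (v m) (v n) = 0)
    (c : ℕ →₀ ℝ) :
    ‖Finsupp.linearCombination ℝ v c‖ ^ 2 = ∑ k ∈ c.support, c k ^ 2 * ‖v k‖ ^ 2 := by
  rw [← real_inner_self_eq_norm_sq, Finsupp.linearCombination_apply, Finsupp.sum, sum_inner]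
  refine Finset.sum_congr rfl fun k hk => ?_
  rw [inner_sum, Finset.sum_eq_single k]
  · rw [real_inner_smul_left, real_inner_smul_right, real_inner_self_eq_norm_sq]; ring
  · intro l _ hl
    rw [real_inner_smul_left, real_inner_smul_right, hv k l hl.symm]; simp
  · intro h; exact absurd hk h

namespace RieszSystem

variable {μ : Measure ℝ} {a : ℝ[X]} {ev : ℕ → ℝ} {P : ℕ → ℝ[X]}

lemma integrable_eval (h : RieszSystem μ a ev P) (q : ℝ[X]) :
    Integrable (fun x => q.eval x) μ :=
  memLp_one_iff_integrable.mp (h.memLp q 1 ENNReal.one_ne_top)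

lemma measurable_rieszFun (k : ℕ) : Measurable (rieszFun a ev P k) := by
  unfold rieszFun
  exact measurable_const.mul ((Real.continuous_sqrt.comp a.continuous).measurable.mul
    (derivative (P k)).continuous.measurable)

/-- Since `√a ≤ 1 + a²`, the function has a polynomial majorant. -/
lemma memLp_rieszFun (h : RieszSystem μ a ev P) (k : ℕ) {r : ℝ≥0∞} (hr : r ≠ ∞) :
    MemLp (rieszFun a ev P k) r μ := by
  have h1 : MemLp (fun x => ((C (1 / √(ev k)) * (1 + a ^ 2) * derivative (P k)).eval x)) r μ :=
    h.memLp _ r hr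
  refine h1.mono (measurable_rieszFun k).aestronglyMeasurable (ae_of_all _ fun x => ?_)
  have h2 : |√(a.eval x)| ≤ |1 + a.eval x ^ 2| := by
    rw [abs_of_nonneg (Real.sqrt_nonneg _), abs_of_nonneg (by positivity)]
    refine Real.sqrt_le_iff.mpr ⟨by positivity, ?_⟩
    nlinarith [sq_nonneg (a.eval x - 1), sq_nonneg (a.eval x), sq_nonneg (a.eval x ^ 2)]
  simp only [rieszFun, Real.norm_eq_abs, eval_mul, eval_C, eval_add, eval_one, eval_pow, abs_mul]
  rw [mul_assoc]
  gcongr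

lemma memLp_polyComb (h : RieszSystem μ a ev P) {r : ℝ≥0∞} (hr : r ≠ ∞) (c : ℕ →₀ ℝ) :
    MemLp (polyComb P c) r μ := by
  have := h.memLp (Finsupp.linearCombination ℝ P c) r hr
  simpa only [← polyComb_eq_eval] using this

lemma memLp_rieszComb (h : RieszSystem μ a ev P) {r : ℝ≥0∞} (hr : r ≠ ∞) (c : ℕ →₀ ℝ) :
    MemLp (rieszComb a ev P c) r μ := by
  have h1 : rieszComb a ev P c = fun x => ∑ k ∈ c.support, c k * rieszFun a ev P k x :=
    funext fun x => rieszComb_apply a ev P c x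
  rw [h1]
  exact memLp_finsetSum _ fun k _ => (h.memLp_rieszFun k hr).const_mul _

/-- The two factors `√a` multiply to `a` almost everywhere, which leaves the inner product of the
derivatives in `L²(a μ)`. -/
lemma integral_rieszFun_mul (h : RieszSystem μ a ev P) (m n : ℕ) :
    ∫ x, rieszFun a ev P m x * rieszFun a ev P n x ∂μ =
      1 / √(ev m) * (1 / √(ev n)) * (ev n * ∫ x, (P m).eval x * (P n).eval x ∂μ) := by
  rw [← h.deriv_inner, ← integral_const_mul]
  refine integral_congr_ae ?_
  filter_upwards [h.nonneg] with x hx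
  have := Real.mul_self_sqrt hx
  simp only [rieszFun]
  linear_combination (1 / √(ev m) * (1 / √(ev n)) * eval x (derivative (P m)) *
    eval x (derivative (P n))) * this

lemma orthoCoeff_polyComb (h : RieszSystem μ a ev P) (c : ℕ →₀ ℝ) (n : ℕ) :
    orthoCoeff μ (fun y => (P n).eval y) (polyComb P c) = c n := by
  unfold orthoCoeff
  have h1 : ∫ x, polyComb P c x * (P n).eval x ∂μ
      = ∑ k ∈ c.support, c k * ∫ x, (P k).eval x * (P n).eval x ∂μ := by
    simp_rw [← integral_const_mul]
    rw [← integral_finsetSum]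
    · refine integral_congr_ae (ae_of_all _ fun x => ?_)
      simp only [polyComb_eq_eval, Finsupp.linearCombination_apply, Finsupp.sum, eval_finsetSum,
        eval_smul, smul_eq_mul, Finset.sum_mul, mul_assoc]
    · intro k _
      have := h.integrable_eval (C (c k) * (P k * P n))
      simpa using this
  rw [h1, div_eq_iff (h.norm_pos n).ne', Finset.sum_eq_single n]
  · simp_rw [pow_two]
  · intro k _ hk
    rw [h.orth k n hk, mul_zero]
  · intro hn
    rw [Finsupp.notMem_support_iff.mp hn, zero_mul]

lemma rieszFun_zero (h : RieszSystem μ a ev P) : rieszFun a ev P 0 = 0 := by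
  ext x; simp [rieszFun, h.derivative_zero]

/-- Test the bound on the constant function `1`, whose norm is positive. This lets `C` pass to
`ENNReal.ofReal C` and back without loss. -/
lemma nonneg_of_boundedOnLp [NeZero μ] [IsFiniteMeasure μ] {R : (ℝ → ℝ) → (ℝ → ℝ) → Prop}
    {p : ℝ≥0∞} (hp : 1 ≤ p) {C : ℝ} (hB : BoundedOnLp μ R p C) : 0 ≤ C := by
  obtain ⟨T, hT, -⟩ := hB
  have : Fact (1 ≤ p) := ⟨hp⟩
  have h1 : MemLp (fun _ : ℝ => (1 : ℝ)) p μ := memLp_const 1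
  have h2 := (norm_nonneg _).trans (hT (h1.toLp _))
  have h3 : 0 < ‖h1.toLp (fun _ : ℝ => (1 : ℝ))‖ := by
    rw [norm_pos_iff]
    intro h0
    have : ∀ᵐ x ∂μ, False := by
      filter_upwards [h1.coeFn_toLp, Lp.coeFn_zero ℝ p μ] with x hx hx'
      rw [h0, hx'] at hx
      exact zero_ne_one hx
    simp [ae_iff] at this
    exact NeZero.ne μ this
  nlinarith

/-- An `L^p` bound for the Riesz transform applies to linear combinations of the `P_k`. -/
lemma eLpNorm_rieszComb_le (h : RieszSystem μ a ev P) {p : ℝ≥0∞} (hp' : p ≠ ∞) {C : ℝ}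
    (hB : BoundedOnLp μ (IsRiesz μ a ev P) p C) (c : ℕ →₀ ℝ) :
    eLpNorm (rieszComb a ev P c) p μ ≤ ENNReal.ofReal C * eLpNorm (polyComb P c) p μ := by
  obtain ⟨T, hT, hR⟩ := hB
  have hf := h.memLp_polyComb hp' c
  have hg := hR _ hf (h.memLp_polyComb ENNReal.ofNat_ne_top c)
  set g := T (hf.toLp _)
  obtain ⟨hg2, hlim⟩ := hg
  have hsum : ∀ᶠ N in atTop, (fun x => g x - ∑ n ∈ Finset.range N,
      orthoCoeff μ (fun y => (P (n + 1)).eval y) (polyComb P c) * rieszFun a ev P (n + 1) x)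
      = fun x => g x - rieszComb a ev P c x := by
    filter_upwards [eventually_ge_atTop (c.support.sup id)] with N hN
    ext x
    congr 1
    have h0 : rieszFun a ev P 0 x = 0 := by rw [h.rieszFun_zero]; rfl
    simp_rw [h.orthoCoeff_polyComb]
    have h1 := Finset.sum_range_succ' (fun k => c k * rieszFun a ev P k x) N
    rw [h0, mul_zero, add_zero] at h1
    rw [← h1, rieszComb_apply]
    symm
    refine Finset.sum_subset (fun k hk => ?_) (fun k _ hk => ?_)
    · exact Finset.mem_range.mpr (Nat.lt_succ_of_le ((Finset.le_sup (f := id) hk).trans hN))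
    · rw [Finsupp.notMem_support_iff.mp hk, zero_mul]
  -- The Riesz series of a finite combination is a finite sum, so the distances in the definition of
  -- the `L²` sum are eventually constant; having limit `0`, they vanish.
  have h0 : eLpNorm (fun x => g x - rieszComb a ev P c x) 2 μ = 0 := by
    refine tendsto_nhds_unique (tendsto_const_nhds.congr' ?_) hlim
    filter_upwards [hsum] with N hN
    rw [hN]
  have hae : g =ᵐ[μ] rieszComb a ev P c := by
    rw [← Pi.sub_def, eLpNorm_eq_zero_iff (hg2.sub (h.memLp_rieszComb ENNReal.ofNat_ne_top c)).1 two_ne_zero] at h0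
    filter_upwards [h0] with x hx
    simpa [sub_eq_zero] using hx
  have hn := hT (hf.toLp _)
  rw [Lp.norm_def, Lp.norm_def] at hn
  rw [← eLpNorm_congr_ae hae, ← eLpNorm_congr_ae hf.coeFn_toLp,
    ← ENNReal.ofReal_toReal (Lp.eLpNorm_ne_top g),
    ← ENNReal.ofReal_toReal (Lp.eLpNorm_ne_top (hf.toLp _)),
    ← ENNReal.ofReal_mul' ENNReal.toReal_nonneg]
  exact ENNReal.ofReal_le_ofReal hn

/-! ### Extension from polynomials to `L^p` -/

/-- Polynomials are dense in `L^r(μ)`. -/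
def _root_.PolynomialDense (μ : Measure ℝ) (r : ℝ≥0∞) : Prop :=
  ∀ f : ℝ → ℝ, MemLp f r μ → ∀ ε : ℝ≥0∞, ε ≠ 0 →
    ∃ q : ℝ[X], eLpNorm (fun x => f x - q.eval x) r μ ≤ ε

lemma exists_polyComb_eq (hdeg : ∀ n, (P n).degree = n) (q : ℝ[X]) :
    ∃ c : ℕ →₀ ℝ, ∀ x, polyComb P c x = q.eval x := by
  let S : Polynomial.Sequence ℝ := ⟨P, hdeg⟩
  have hS := S.span fun i => isUnit_iff_ne_zero.mpr (leadingCoeff_ne_zero.mpr (S.ne_zero i))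
  have hq : q ∈ Submodule.span ℝ (Set.range P) := by
    change q ∈ Submodule.span ℝ (Set.range S); rw [hS]; trivial
  obtain ⟨c, hc⟩ := (Finsupp.mem_span_range_iff_exists_finsupp).mp hq
  refine ⟨c, fun x => ?_⟩
  rw [polyComb_eq_eval, ← hc, Finsupp.linearCombination_apply]

/-- The linear combinations of the `P_k` as elements of `L^r`. -/
noncomputable def polyLp (h : RieszSystem μ a ev P) {r : ℝ≥0∞} (hr : r ≠ ∞) :
    (ℕ →₀ ℝ) →ₗ[ℝ] Lp ℝ r μ :=
  linearToLp (polyComb P) (h.memLp_polyComb hr)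

/-- The Riesz transforms of the linear combinations of the `P_k` as elements of `L^r`. -/
noncomputable def rieszLp (h : RieszSystem μ a ev P) {r : ℝ≥0∞} (hr : r ≠ ∞) :
    (ℕ →₀ ℝ) →ₗ[ℝ] Lp ℝ r μ :=
  linearToLp (rieszComb a ev P) (h.memLp_rieszComb hr)

lemma coeFn_polyLp (h : RieszSystem μ a ev P) {r : ℝ≥0∞} (hr : r ≠ ∞) (c : ℕ →₀ ℝ) :
    h.polyLp hr c =ᵐ[μ] polyComb P c := (h.memLp_polyComb hr c).coeFn_toLp

lemma coeFn_rieszLp (h : RieszSystem μ a ev P) {r : ℝ≥0∞} (hr : r ≠ ∞) (c : ℕ →₀ ℝ) :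
    h.rieszLp hr c =ᵐ[μ] rieszComb a ev P c := (h.memLp_rieszComb hr c).coeFn_toLp

lemma denseRange_polyLp (h : RieszSystem μ a ev P) (hdeg : ∀ n, (P n).degree = n)
    {r : ℝ≥0∞} [Fact (1 ≤ r)] (hr : r ≠ ∞) (hd : PolynomialDense μ r) :
    DenseRange (h.polyLp hr) := by
  refine Metric.denseRange_iff.mpr fun f ε hε => ?_
  obtain ⟨q, hq⟩ := hd f (Lp.memLp f) (ENNReal.ofReal (ε / 2)) (by simpa using hε)
  obtain ⟨c, hc⟩ := exists_polyComb_eq hdeg q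
  refine ⟨c, ?_⟩
  rw [Lp.dist_def]
  have h1 : eLpNorm (⇑f - ⇑(h.polyLp hr c)) r μ ≤ ENNReal.ofReal (ε / 2) := by
    refine (eLpNorm_congr_ae ?_).trans_le hq
    filter_upwards [h.coeFn_polyLp hr c] with x hx
    simp [hx, hc]
  exact (ENNReal.toReal_le_of_le_ofReal (by positivity) h1).trans_lt (by linarith)

lemma linearCombination_polyLp (h : RieszSystem μ a ev P) {r : ℝ≥0∞} (hr : r ≠ ∞) (c : ℕ →₀ ℝ) :
    Finsupp.linearCombination ℝ (fun k => h.polyLp hr (Finsupp.single k 1)) c = h.polyLp hr c := by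
  rw [Finsupp.linearCombination_apply]
  simp_rw [← map_smul]
  rw [← map_finsuppSum]
  simp

lemma linearCombination_rieszLp (h : RieszSystem μ a ev P) {r : ℝ≥0∞} (hr : r ≠ ∞)
    (c : ℕ →₀ ℝ) :
    Finsupp.linearCombination ℝ (fun k => h.rieszLp hr (Finsupp.single k 1)) c
      = h.rieszLp hr c := by
  rw [Finsupp.linearCombination_apply]
  simp_rw [← map_smul]
  rw [← map_finsuppSum]
  simp

lemma inner_polyLp_single (h : RieszSystem μ a ev P) (f : Lp ℝ 2 μ) (m : ℕ) :
    inner ℝ (h.polyLp (r := 2) ENNReal.ofNat_ne_top (Finsupp.single m 1)) f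
      = ∫ x, f x * (P m).eval x ∂μ := by
  rw [L2.inner_def]
  refine integral_congr_ae ?_
  filter_upwards [h.coeFn_polyLp (r := 2) ENNReal.ofNat_ne_top (Finsupp.single m 1)] with x hx
  rw [hx]
  simp [polyComb]

lemma inner_polyLp_single_single (h : RieszSystem μ a ev P) (m n : ℕ) :
    inner ℝ (h.polyLp (r := 2) ENNReal.ofNat_ne_top (Finsupp.single m 1))
      (h.polyLp (r := 2) ENNReal.ofNat_ne_top (Finsupp.single n 1))
      = ∫ x, (P m).eval x * (P n).eval x ∂μ := by
  rw [h.inner_polyLp_single]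
  refine integral_congr_ae ?_
  filter_upwards [h.coeFn_polyLp (r := 2) ENNReal.ofNat_ne_top (Finsupp.single n 1)] with x hx
  rw [hx]
  simp [polyComb, mul_comm]

lemma inner_rieszLp_single_single (h : RieszSystem μ a ev P) (m n : ℕ) :
    inner ℝ (h.rieszLp (r := 2) ENNReal.ofNat_ne_top (Finsupp.single m 1))
      (h.rieszLp (r := 2) ENNReal.ofNat_ne_top (Finsupp.single n 1))
      = 1 / √(ev m) * (1 / √(ev n)) * (ev n * ∫ x, (P m).eval x * (P n).eval x ∂μ) := by
  rw [← h.integral_rieszFun_mul, L2.inner_def]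
  refine integral_congr_ae ?_
  filter_upwards [h.coeFn_rieszLp (r := 2) ENNReal.ofNat_ne_top (Finsupp.single m 1),
    h.coeFn_rieszLp (r := 2) ENNReal.ofNat_ne_top (Finsupp.single n 1)] with x hx hx'
  rw [hx, hx']
  simp [rieszComb, mul_comm]

/-- Both families are orthogonal, and the image of `P_k` has the same norm as `P_k` for `k ≥ 1` and
is zero for `k = 0`; Pythagoras then compares the two sums term by term. -/
lemma norm_rieszLp_le (h : RieszSystem μ a ev P) (c : ℕ →₀ ℝ) :
    ‖h.rieszLp (r := 2) ENNReal.ofNat_ne_top c‖ ≤ 1 * ‖h.polyLp (r := 2) ENNReal.ofNat_ne_top c‖ := by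
  rw [one_mul]
  refine (sq_le_sq₀ (norm_nonneg _) (norm_nonneg _)).mp ?_
  rw [← h.linearCombination_rieszLp, ← h.linearCombination_polyLp,
    norm_sq_linearCombination_of_orthogonal, norm_sq_linearCombination_of_orthogonal]
  · refine Finset.sum_le_sum fun k _ => mul_le_mul_of_nonneg_left ?_ (sq_nonneg _)
    rw [← real_inner_self_eq_norm_sq, ← real_inner_self_eq_norm_sq,
      h.inner_rieszLp_single_single, h.inner_polyLp_single_single]
    have h2 : 0 ≤ ∫ x, (P k).eval x * (P k).eval x ∂μ := by
      simpa only [pow_two] using (h.norm_pos k).le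
    rcases k with - | k
    · rw [← h.deriv_inner]
      simpa [h.derivative_zero] using h2
    · have h3 := (h.ev_pos k)
      have h4 := Real.mul_self_sqrt h3.le
      have h5 := Real.sqrt_pos.mpr h3
      refine le_of_eq ?_
      field_simp
      rw [pow_two, h4]
  · intro m n hmn
    rw [h.inner_polyLp_single_single, h.orth m n hmn]
  · intro m n hmn
    rw [h.inner_rieszLp_single_single, h.orth m n hmn]; simp

/-- The orthogonal expansion of `f ∈ L²(μ)`. -/
lemma hasSum_orthoCoeff_smul (h : RieszSystem μ a ev P) (hdeg : ∀ n, (P n).degree = n)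
    (hd : PolynomialDense μ 2) (f : Lp ℝ 2 μ) :
    HasSum (fun k => orthoCoeff μ (fun y => (P k).eval y) f •
      h.polyLp (r := 2) ENNReal.ofNat_ne_top (Finsupp.single k 1)) f := by
  set v : ℕ → Lp ℝ 2 μ := fun k => h.polyLp (r := 2) ENNReal.ofNat_ne_top (Finsupp.single k 1) with hv
  have hnorm : ∀ k, ‖v k‖ ^ 2 = ∫ x, (P k).eval x ^ 2 ∂μ := fun k => by
    rw [← real_inner_self_eq_norm_sq, hv, h.inner_polyLp_single_single]; simp_rw [pow_two]
  have hpos : ∀ k, 0 < ‖v k‖ := fun k => by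
    have := (hnorm k).symm ▸ h.norm_pos k
    exact (sq_pos_iff.mp this).lt_of_le' (norm_nonneg _)
  have hon : Orthonormal ℝ fun k => ‖v k‖⁻¹ • v k := by
    refine ⟨fun k => ?_, fun m n hmn => ?_⟩
    · rw [norm_smul, norm_inv, norm_norm, inv_mul_cancel₀ (hpos k).ne']
    · beta_reduce
      rw [real_inner_smul_left, real_inner_smul_right, hv, h.inner_polyLp_single_single,
        h.orth m n hmn]; simp
  have hspan : ⊤ ≤ (Submodule.span ℝ (Set.range fun k => ‖v k‖⁻¹ • v k)).topologicalClosure := by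
    intro g _
    have hg := h.denseRange_polyLp hdeg ENNReal.ofNat_ne_top hd g
    refine closure_mono ?_ hg
    rintro _ ⟨c, rfl⟩
    rw [← h.linearCombination_polyLp, Finsupp.linearCombination_apply]
    refine Submodule.sum_mem _ fun k _ => Submodule.smul_mem _ _ ?_
    have : v k = ‖v k‖ • (‖v k‖⁻¹ • v k) := by
      rw [smul_smul, mul_inv_cancel₀ (hpos k).ne', one_smul]
    change v k ∈ _
    rw [this]
    exact Submodule.smul_mem _ _ (Submodule.subset_span ⟨k, rfl⟩)
  have hs := (HilbertBasis.mk hon hspan).hasSum_repr f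
  convert hs using 2 with k
  rw [HilbertBasis.repr_apply_apply, HilbertBasis.coe_mk, smul_smul, real_inner_smul_left, hv,
    h.inner_polyLp_single]
  congr 1
  have h1 := (hpos k).ne'
  rw [orthoCoeff, ← hnorm]
  simp only [hv] at h1 ⊢
  field_simp

lemma exists_tendsto_polyComb (hdeg : ∀ n, (P n).degree = n) {r : ℝ≥0∞}
    (hd : PolynomialDense μ r) {f : ℝ → ℝ} (hf : MemLp f r μ) :
    ∃ c : ℕ → ℕ →₀ ℝ, Tendsto (fun j => eLpNorm (polyComb P (c j) - f) r μ) atTop (𝓝 0) := by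
  have h1 : ∀ j : ℕ, ∃ c : ℕ →₀ ℝ, eLpNorm (polyComb P c - f) r μ ≤ ((j : ℝ≥0∞) + 1)⁻¹ := by
    intro j
    obtain ⟨q, hq⟩ := hd f hf ((j : ℝ≥0∞) + 1)⁻¹
      (ENNReal.inv_ne_zero.mpr (ENNReal.add_ne_top.mpr ⟨ENNReal.natCast_ne_top j,
        ENNReal.one_ne_top⟩))
    obtain ⟨c, hc⟩ := exists_polyComb_eq hdeg q
    refine ⟨c, ?_⟩
    rw [eLpNorm_sub_comm]
    convert hq using 2
    ext x
    simp [hc]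
  choose c hc using h1
  refine ⟨c, tendsto_of_tendsto_of_tendsto_of_le_of_le tendsto_const_nhds ?_
    (fun _ => zero_le) hc⟩
  have := (tendsto_add_atTop_iff_nat 1).mpr ENNReal.tendsto_inv_nat_nhds_zero
  simpa using this

/-- If the polynomials are dense, bounds on linear combinations of the `P_k` give the
boundedness of the Riesz transform. -/
theorem boundedOnLp [IsFiniteMeasure μ] (h : RieszSystem μ a ev P)
    (hdeg : ∀ n, (P n).degree = n) (hd : ∀ r : ℝ≥0∞, 1 ≤ r → r ≠ ∞ → PolynomialDense μ r)
    {p : ℝ≥0∞} (hp : 1 ≤ p) (hp' : p ≠ ∞) {C : ℝ} (hC : 0 ≤ C)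
    (hB : ∀ c, eLpNorm (rieszComb a ev P c) p μ ≤ ENNReal.ofReal C * eLpNorm (polyComb P c) p μ) :
    BoundedOnLp μ (IsRiesz μ a ev P) p C := by
  have : Fact (1 ≤ p) := ⟨hp⟩
  have hp2 : (2 : ℝ≥0∞) ≠ ∞ := ENNReal.ofNat_ne_top
  have hbound : ∀ c, ‖h.rieszLp hp' c‖ ≤ C * ‖h.polyLp hp' c‖ := fun c => by
    have h1 := hB c
    rw [← eLpNorm_congr_ae (h.coeFn_polyLp hp' c),
      ← eLpNorm_congr_ae (h.coeFn_rieszLp hp' c)] at h1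
    have h2 := ENNReal.toReal_mono
      (ENNReal.mul_ne_top ENNReal.ofReal_ne_top (Lp.eLpNorm_ne_top _)) h1
    rwa [ENNReal.toReal_mul, ENNReal.toReal_ofReal hC, ← Lp.norm_def, ← Lp.norm_def] at h2
  have hdp := h.denseRange_polyLp hdeg hp' (hd p hp hp')
  have hd2 := h.denseRange_polyLp hdeg hp2 (hd 2 (by norm_num) hp2)
  let T := (h.rieszLp hp').extendOfNorm (h.polyLp hp')
  let T₂ := (h.rieszLp hp2).extendOfNorm (h.polyLp hp2)
  have hT : ∀ c, T (h.polyLp hp' c) = h.rieszLp hp' c :=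
    LinearMap.extendOfNorm_eq hdp ⟨C, hbound⟩
  have hT₂ : ∀ c, T₂ (h.polyLp hp2 c) = h.rieszLp hp2 c :=
    LinearMap.extendOfNorm_eq hd2 ⟨1, h.norm_rieszLp_le⟩
  refine ⟨T.toLinearMap, LinearMap.norm_extendOfNorm_apply_le hdp C hbound, fun f hf hf2 => ?_⟩
  -- Approximation in `L^max(p,2)` of a finite measure gives one sequence of polynomials that
  -- converges to `f` in `L^p` and in `L²` simultaneously.
  have hmax : MemLp f (max p 2) μ := by
    rcases max_cases p 2 with ⟨h1, -⟩ | ⟨h1, -⟩ <;> rwa [h1]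
  obtain ⟨c, hc⟩ := exists_tendsto_polyComb hdeg
    (hd (max p 2) (le_max_of_le_left hp) (max_lt hp'.lt_top hp2.lt_top).ne) hmax
  have hsub : ∀ r : ℝ≥0∞, r ≠ ∞ → r ≤ max p 2 →
      Tendsto (fun j => eLpNorm (polyComb P (c j) - f) r μ) atTop (𝓝 0) := by
    intro r hr hrm
    have h1 : ∀ j, eLpNorm (polyComb P (c j) - f) r μ ≤ eLpNorm (polyComb P (c j) - f) (max p 2) μ
        * μ Set.univ ^ (1 / r.toReal - 1 / (max p 2).toReal) := fun j =>
      eLpNorm_le_eLpNorm_mul_rpow_measure_univ hrm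
        ((h.memLp_polyComb (max_lt hp'.lt_top hp2.lt_top).ne _).1.sub hmax.1)
    refine tendsto_of_tendsto_of_tendsto_of_le_of_le tendsto_const_nhds ?_
      (fun _ => zero_le) h1
    rcases eq_or_ne (μ Set.univ) 0 with h0 | h0
    · rw [Measure.measure_univ_eq_zero.mp h0]; simp
    · have := ENNReal.Tendsto.mul_const hc
        (Or.inr (ENNReal.rpow_ne_top_of_ne_zero h0 (measure_ne_top μ Set.univ)
          (y := 1 / r.toReal - 1 / (max p 2).toReal)))
      simpa using this
  -- Convergence in measure is the common ground on which the limits taken in `L^p` and in `L²` can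
  -- be compared.
  have hconv : ∀ (r : ℝ≥0∞) [Fact (1 ≤ r)] (hr : r ≠ ∞) (hrm : r ≤ max p 2) (hfr : MemLp f r μ)
      (U : Lp ℝ r μ →L[ℝ] Lp ℝ r μ) (hU : ∀ c, U (h.polyLp hr c) = h.rieszLp hr c),
      TendstoInMeasure μ (fun j => rieszComb a ev P (c j)) atTop (U (hfr.toLp f)) := by
    intro r _ hr hrm hfr U hU
    have h1 : Tendsto (fun j => h.polyLp hr (c j)) atTop (𝓝 (hfr.toLp f)) := by
      rw [Lp.tendsto_Lp_iff_tendsto_eLpNorm']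
      refine (hsub r hr hrm).congr fun j => eLpNorm_congr_ae ?_
      filter_upwards [h.coeFn_polyLp hr (c j), hfr.coeFn_toLp] with x hx hx'
      simp [hx, hx']
    have h2 := (U.continuous.tendsto _).comp h1
    refine (tendstoInMeasure_of_tendsto_Lp h2).congr_left fun j => ?_
    simp only [Function.comp_apply, hU]
    exact h.coeFn_rieszLp hr (c j)
  have hae : T₂ (hf2.toLp f) =ᵐ[μ] T (hf.toLp f) :=
    tendstoInMeasure_ae_unique (hconv 2 hp2 (le_max_right _ _) hf2 T₂ hT₂)
      (hconv p hp' (le_max_left _ _) hf T hT)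
  -- The continuous operator on `L²` applies termwise to the orthogonal expansion. The index shift
  -- below loses nothing, because the term `k = 0` is sent to zero.
  have hsum := (h.hasSum_orthoCoeff_smul hdeg (hd 2 (by norm_num) hp2) (hf2.toLp f)).mapL T₂
  have hlim := ((tendsto_add_atTop_iff_nat 1).mpr hsum.tendsto_sum_nat)
  rw [Lp.tendsto_Lp_iff_tendsto_eLpNorm'] at hlim
  refine ⟨(memLp_congr_ae hae).mp (Lp.memLp _), hlim.congr fun N => ?_⟩
  rw [eLpNorm_sub_comm]
  refine eLpNorm_congr_ae ?_
  have hco : ∀ k, orthoCoeff μ (fun y => (P k).eval y) (hf2.toLp f)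
      = orthoCoeff μ (fun y => (P k).eval y) f := fun k => by
    unfold orthoCoeff
    congr 1
    refine integral_congr_ae ?_
    filter_upwards [hf2.coeFn_toLp] with x hx
    rw [hx]
  have hk : ∀ᵐ x ∂μ, ∀ k, h.rieszLp hp2 (Finsupp.single k 1) x = rieszFun a ev P k x := by
    rw [ae_all_iff]
    intro k
    filter_upwards [h.coeFn_rieszLp hp2 (Finsupp.single k 1)] with x hx
    rw [hx]; simp [rieszComb]
  have hs : ∀ᵐ x ∂μ, (∑ k ∈ Finset.range (N + 1), T₂ (orthoCoeff μ (fun y => (P k).eval y)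
      (hf2.toLp f) • h.polyLp hp2 (Finsupp.single k 1)) : Lp ℝ 2 μ) x
      = ∑ k ∈ Finset.range (N + 1), T₂ (orthoCoeff μ (fun y => (P k).eval y)
      (hf2.toLp f) • h.polyLp hp2 (Finsupp.single k 1)) x := by
    filter_upwards [Lp.coeFn_finsetSum (Finset.range (N + 1)) fun k => T₂ (orthoCoeff μ
      (fun y => (P k).eval y) (hf2.toLp f) • h.polyLp hp2 (Finsupp.single k 1))] with x hx
    rw [hx, Finset.sum_apply]
  have hm : ∀ᵐ x ∂μ, ∀ k, T₂ (orthoCoeff μ (fun y => (P k).eval y)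
      (hf2.toLp f) • h.polyLp hp2 (Finsupp.single k 1)) x
      = orthoCoeff μ (fun y => (P k).eval y) f * h.rieszLp hp2 (Finsupp.single k 1) x := by
    rw [ae_all_iff]
    intro k
    rw [map_smul, hT₂, hco]
    filter_upwards [Lp.coeFn_smul (orthoCoeff μ (fun y => (P k).eval y) f)
      (h.rieszLp hp2 (Finsupp.single k 1))] with x hx
    rw [hx]; rfl
  filter_upwards [hk, hs, hm, hae] with x h1 h2 h3 h4
  have h0 : rieszFun a ev P 0 x = 0 := by rw [h.rieszFun_zero]; rfl
  rw [Pi.sub_apply, h2, h4, Finset.sum_range_succ']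
  simp only [h3, h1, h0, mul_zero, add_zero]
  rfl

end RieszSystem

/-! ### Riesz systems from eigenfunctions and a Pearson equation -/

/-- A nonzero polynomial has finitely many zeros, and these are null for an absolutely continuous
measure. -/
lemma integral_eval_sq_pos {μ : Measure ℝ} [NeZero μ] (hμ : μ ≪ volume) {q : ℝ[X]} (hq : q ≠ 0)
    (hi : Integrable (fun x => q.eval x ^ 2) μ) : 0 < ∫ x, q.eval x ^ 2 ∂μ := by
  rw [integral_pos_iff_support_of_nonneg (fun x => sq_nonneg _) hi]
  have h1 : μ (Function.support fun x => q.eval x ^ 2)ᶜ = 0 := by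
    refine hμ (Set.Finite.measure_zero (q.rootSet_finite ℝ |>.subset fun x hx => ?_) _)
    simp only [Set.mem_compl_iff, Function.mem_support, not_not] at hx
    rw [mem_rootSet]
    exact ⟨hq, by simpa using hx⟩
  rw [pos_iff_ne_zero]
  intro h2
  have h3 := measure_union_le (μ := μ) (Function.support fun x => q.eval x ^ 2)
    (Function.support fun x => q.eval x ^ 2)ᶜ
  rw [Set.union_compl_self, h1, h2, add_zero] at h3
  exact NeZero.ne μ (Measure.measure_univ_eq_zero.mp (le_antisymm h3 zero_le))

/-- Polynomial eigenfunctions of `a ∂² + b ∂`, where `μ` satisfies the Pearson equation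
`(a μ)' = b μ`, form a `RieszSystem`. -/
lemma RieszSystem.of_eigenfunctions {μ : Measure ℝ} [NeZero μ] (hμ : μ ≪ volume) {a b : ℝ[X]}
    {ev : ℕ → ℝ} {P : ℕ → ℝ[X]}
    (memLp : ∀ (q : ℝ[X]) (r : ℝ≥0∞), r ≠ ∞ → MemLp (fun x => q.eval x) r μ)
    (nonneg : ∀ᵐ x ∂μ, 0 ≤ a.eval x)
    (hparts : ∀ q : ℝ[X], ∫ x, (a * derivative q + b * q).eval x ∂μ = 0)
    (heig : ∀ n, a * derivative (derivative (P n)) + b * derivative (P n) = -(C (ev n) * P n))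
    (hinj : Function.Injective ev) (ev_pos : ∀ n, 0 < ev (n + 1))
    (derivative_zero : derivative (P 0) = 0) (hP : ∀ n, P n ≠ 0) : RieszSystem μ a ev P := by
  have hint : ∀ q : ℝ[X], Integrable (fun x => q.eval x) μ := fun q =>
    memLp_one_iff_integrable.mp (memLp q 1 ENNReal.one_ne_top)
  have hd : ∀ m n, ∫ x, a.eval x * (derivative (P m)).eval x * (derivative (P n)).eval x ∂μ
      = ev n * ∫ x, (P m).eval x * (P n).eval x ∂μ := by
    intro m n
    -- With this test polynomial, the integration by parts expresses the symmetry of the operator: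
    -- the eigenvalue equation of `P n` turns it into the Dirichlet form identity.
    have h1 := hparts (derivative (P n) * P m)
    have h2 : a * derivative (derivative (P n) * P m) + b * (derivative (P n) * P m)
        = a * derivative (P m) * derivative (P n) - C (ev n) * (P m * P n) := by
      rw [derivative_mul]
      linear_combination P m * heig n
    rw [h2] at h1
    simp only [eval_sub, eval_mul, eval_C] at h1
    rw [integral_sub (by simpa using hint (a * derivative (P m) * derivative (P n)))
      (by simpa using hint (C (ev n) * (P m * P n))), integral_const_mul] at h1
    linarith
  refine ⟨memLp, nonneg, ev_pos, derivative_zero, fun m n hmn => ?_, hd, fun n =>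
    integral_eval_sq_pos hμ (hP n) ((hint (P n ^ 2)).congr (by simp))⟩
  have h1 := hd m n
  have h2 := hd n m
  have h3 : (fun x => a.eval x * (derivative (P n)).eval x * (derivative (P m)).eval x)
      = fun x => a.eval x * (derivative (P m)).eval x * (derivative (P n)).eval x := by
    ext x; ring
  have h4 : (fun x => (P n).eval x * (P m).eval x) = fun x => (P m).eval x * (P n).eval x := by
    ext x; ring
  rw [h3, h4, h1] at h2
  -- The Dirichlet form is symmetric in `m` and `n`, so distinct eigenvalues force orthogonality.
  have h5 : (ev n - ev m) * ∫ x, (P m).eval x * (P n).eval x ∂μ = 0 := by linarith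
  exact (mul_eq_zero.mp h5).resolve_left (sub_ne_zero.mpr fun e => hmn (hinj e).symm)

/-! ### Density of polynomials from exponential moments -/

/-- Dominated convergence for the `r`-th powers, with majorant `(2D)^r`, since the limit `g`
inherits the bound `D`. -/
lemma tendsto_eLpNorm_sub_of_dominated {μ : Measure ℝ} {r : ℝ≥0∞} (hr0 : r ≠ 0) (hr : r ≠ ∞)
    {u : ℕ → ℝ → ℝ} {g D : ℝ → ℝ} (hu : ∀ N, AEStronglyMeasurable (u N) μ)
    (hg : AEStronglyMeasurable g μ) (hD : MemLp D r μ) (hbound : ∀ N, ∀ᵐ x ∂μ, |u N x| ≤ D x)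
    (hlim : ∀ᵐ x ∂μ, Tendsto (fun N => u N x) atTop (𝓝 (g x))) :
    Tendsto (fun N => eLpNorm (fun x => g x - u N x) r μ) atTop (𝓝 0) := by
  have hr' : 0 < r.toReal := ENNReal.toReal_pos hr0 hr
  have h1 : Tendsto (fun N => ∫⁻ x, ‖g x - u N x‖ₑ ^ r.toReal ∂μ) atTop
      (𝓝 (∫⁻ _, 0 ∂μ)) := by
    refine tendsto_lintegral_of_dominated_convergence' (fun x => ‖2 * D x‖ₑ ^ r.toReal)
      (fun N => ((hg.sub (hu N)).enorm.pow_const _)) (fun N => ?_) ?_ ?_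
    · filter_upwards [hbound N, hlim, ae_all_iff.mpr hbound] with x h1 h2 h3
      refine ENNReal.rpow_le_rpow ?_ hr'.le
      rw [enorm_le_iff_norm_le, Real.norm_eq_abs, Real.norm_eq_abs]
      have h4 : |g x| ≤ D x := le_of_tendsto (continuous_abs.tendsto _ |>.comp h2)
        (Eventually.of_forall h3)
      calc |g x - u N x| ≤ |g x| + |u N x| := abs_sub _ _
        _ ≤ 2 * D x := by linarith
        _ ≤ |2 * D x| := le_abs_self _
    · have := (hD.const_mul 2)
      exact (lintegral_rpow_enorm_lt_top_of_eLpNorm_lt_top hr0 hr this.2).ne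
    · filter_upwards [hlim] with x hx
      have h2 : Tendsto (fun N => ‖g x - u N x‖ₑ) atTop (𝓝 0) := by
        have := (tendsto_const_nhds (x := g x)).sub hx
        rw [sub_self] at this
        simpa using this.enorm
      have h3 := (ENNReal.continuous_rpow_const (y := r.toReal)).tendsto 0 |>.comp h2
      rwa [ENNReal.zero_rpow_of_pos hr'] at h3
  simp_rw [eLpNorm_eq_lintegral_rpow_enorm_toReal hr0 hr]
  rw [lintegral_zero] at h1
  have h3 := (ENNReal.continuous_rpow_const (y := 1 / r.toReal)).tendsto 0 |>.comp h1
  rwa [ENNReal.zero_rpow_of_pos (by positivity)] at h3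

/-- `g` belongs to `L^r(μ)` and to the closure of the polynomials there. -/
def PolyApprox (μ : Measure ℝ) (r : ℝ≥0∞) (g : ℝ → ℝ) : Prop :=
  MemLp g r μ ∧ ∀ ε : ℝ≥0∞, ε ≠ 0 → ∃ q : ℝ[X], eLpNorm (fun x => g x - q.eval x) r μ ≤ ε

namespace PolyApprox

variable {μ : Measure ℝ} {r : ℝ≥0∞} {f g : ℝ → ℝ}

lemma of_polynomial {q : ℝ[X]} (hq : MemLp (fun x => q.eval x) r μ) :
    PolyApprox μ r fun x => q.eval x :=
  ⟨hq, fun ε _ => ⟨q, by simp⟩⟩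

lemma of_approx (hg : MemLp g r μ) (hr : 1 ≤ r)
    (h : ∀ ε : ℝ≥0∞, ε ≠ 0 → ∃ f, PolyApprox μ r f ∧ eLpNorm (fun x => g x - f x) r μ ≤ ε)
    (hpol : ∀ q : ℝ[X], MemLp (fun x => q.eval x) r μ) : PolyApprox μ r g := by
  refine ⟨hg, fun ε hε => ?_⟩
  obtain ⟨f, hf, hfg⟩ := h (ε / 2) (by simpa using hε)
  obtain ⟨q, hq⟩ := hf.2 (ε / 2) (by simpa using hε)
  refine ⟨q, ?_⟩
  have h1 : (fun x => g x - q.eval x) = (fun x => g x - f x) + fun x => f x - q.eval x := by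
    ext x; simp
  rw [h1, ← ENNReal.add_halves ε]
  exact (eLpNorm_add_le (hg.1.sub hf.1.1) (hf.1.1.sub (hpol q).1) hr).trans (add_le_add hfg hq)

lemma add (hf : PolyApprox μ r f) (hg : PolyApprox μ r g) (hr : 1 ≤ r)
    (hpol : ∀ q : ℝ[X], MemLp (fun x => q.eval x) r μ) :
    PolyApprox μ r fun x => f x + g x := by
  refine ⟨hf.1.add hg.1, fun ε hε => ?_⟩
  obtain ⟨q₁, h₁⟩ := hf.2 (ε / 2) (by simpa using hε)
  obtain ⟨q₂, h₂⟩ := hg.2 (ε / 2) (by simpa using hε)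
  refine ⟨q₁ + q₂, ?_⟩
  have h1 : (fun x => f x + g x - (q₁ + q₂).eval x)
      = (fun x => f x - q₁.eval x) + fun x => g x - q₂.eval x := by
    ext x; simp; ring
  rw [h1, ← ENNReal.add_halves ε]
  exact (eLpNorm_add_le (hf.1.1.sub (hpol q₁).1) (hg.1.1.sub (hpol q₂).1) hr).trans
    (add_le_add h₁ h₂)

lemma const_mul (hf : PolyApprox μ r f) (t : ℝ) : PolyApprox μ r fun x => t * f x := by
  refine ⟨hf.1.const_mul t, fun ε hε => ?_⟩
  rcases eq_or_ne t 0 with rfl | ht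
  · exact ⟨0, by simp⟩
  have ht' : ‖t‖ₑ ≠ 0 := by simpa using ht
  obtain ⟨q, hq⟩ := hf.2 (ε / ‖t‖ₑ) (ENNReal.div_ne_zero.mpr ⟨hε, enorm_ne_top⟩)
  refine ⟨C t * q, ?_⟩
  have h1 : (fun x => t * f x - (C t * q).eval x) = t • fun x => f x - q.eval x := by
    ext x; simp; ring
  rw [h1, eLpNorm_const_smul]
  exact (mul_le_mul_right hq _).trans (ENNReal.mul_div_le)

lemma sum (hr : 1 ≤ r) (hpol : ∀ q : ℝ[X], MemLp (fun x => q.eval x) r μ) {ι : Type*}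
    (s : Finset ι) (t : ι → ℝ) (u : ι → ℝ → ℝ) (h : ∀ i ∈ s, PolyApprox μ r (u i)) :
    PolyApprox μ r fun x => ∑ i ∈ s, t i * u i x := by
  classical
  induction s using Finset.induction_on with
  | empty =>
    have h0 : PolyApprox μ r fun x => (0 : ℝ[X]).eval x := of_polynomial (hpol 0)
    simpa using h0
  | insert i s hi ih =>
    simp_rw [Finset.sum_insert hi]
    exact ((h i (Finset.mem_insert_self i s)).const_mul (t i)).add
      (ih fun j hj => h j (Finset.mem_insert_of_mem hj)) hr hpol

lemma of_dominated (hr : 1 ≤ r) (hr' : r ≠ ∞)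
    (hpol : ∀ q : ℝ[X], MemLp (fun x => q.eval x) r μ) {u : ℕ → ℝ → ℝ} {D : ℝ → ℝ}
    (hu : ∀ N, PolyApprox μ r (u N)) (hg : MemLp g r μ) (hD : MemLp D r μ)
    (hbound : ∀ N, ∀ᵐ x ∂μ, |u N x| ≤ D x)
    (hlim : ∀ᵐ x ∂μ, Tendsto (fun N => u N x) atTop (𝓝 (g x))) : PolyApprox μ r g := by
  refine of_approx hg hr (fun ε hε => ?_) hpol
  have h1 := tendsto_eLpNorm_sub_of_dominated (zero_lt_one.trans_le hr).ne' hr'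
    (fun N => (hu N).1.1) hg.1 hD hbound hlim
  obtain ⟨N, hN⟩ := (h1.eventually (ge_mem_nhds (pos_iff_ne_zero.mpr hε))).exists
  exact ⟨u N, hu N, hN⟩

section ExpMoment

variable {φ w : ℝ[X]} {t : ℝ}

/-- Half of the exponent `2tφ` absorbs `φ^m`, through `(tφ)^m / m! ≤ e^(tφ)`. The result is the
majorant for the power series in `mul_exp_neg`. -/
lemma memLp_mul_exp (hφ : ∀ᵐ x ∂μ, 0 ≤ φ.eval x) (ht : 0 < t)
    (hexp : MemLp (fun x => w.eval x * Real.exp (2 * t * φ.eval x)) r μ) (m : ℕ) :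
    MemLp (fun x => w.eval x * φ.eval x ^ m * Real.exp (t * φ.eval x)) r μ := by
  refine (hexp.const_mul ((m.factorial : ℝ) / t ^ m)).mono (by fun_prop) ?_
  filter_upwards [hφ] with x hx
  have h1 := Real.pow_div_factorial_le_exp (t * φ.eval x) (by positivity) m
  have h2 : φ.eval x ^ m ≤ (m.factorial : ℝ) / t ^ m * Real.exp (t * φ.eval x) := by
    rw [div_le_iff₀ (by positivity), mul_pow] at h1
    rw [div_mul_eq_mul_div, le_div_iff₀ (by positivity)]
    linarith
  have h3 : Real.exp (2 * t * φ.eval x) = Real.exp (t * φ.eval x) * Real.exp (t * φ.eval x) := by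
    rw [← Real.exp_add]; ring_nf
  simp only [Real.norm_eq_abs, abs_mul, Real.abs_exp, abs_pow, abs_of_nonneg hx]
  rw [abs_of_nonneg (by positivity : 0 ≤ (m.factorial : ℝ) / t ^ m), h3]
  calc |w.eval x| * φ.eval x ^ m * Real.exp (t * φ.eval x)
      ≤ |w.eval x| * ((m.factorial : ℝ) / t ^ m * Real.exp (t * φ.eval x))
        * Real.exp (t * φ.eval x) := by gcongr
    _ = _ := by ring

/-- Induction on `k` expands only one new factor `e^(-tφ)` in its power series. The partial sums of
this factor are at most `e^(tφ)` and the older factors are at most `1`, so the same exponential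
moment serves for every `k`. The exponent `m` must stay general, because the expansion produces
higher powers of `φ`. -/
lemma mul_exp_neg (hr : 1 ≤ r) (hr' : r ≠ ∞)
    (hpol : ∀ q : ℝ[X], MemLp (fun x => q.eval x) r μ) (hφ : ∀ᵐ x ∂μ, 0 ≤ φ.eval x) (ht : 0 < t)
    (hexp : MemLp (fun x => w.eval x * Real.exp (2 * t * φ.eval x)) r μ) (k : ℕ) :
    ∀ m : ℕ, PolyApprox μ r
      fun x => w.eval x * φ.eval x ^ m * Real.exp (-t * φ.eval x) ^ k := by
  induction k with
  | zero =>
    intro m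
    have : PolyApprox μ r fun x => (w * φ ^ m).eval x := of_polynomial (hpol _)
    simpa using this
  | succ k ih =>
    intro m
    have hle : ∀ x, 0 ≤ φ.eval x → ∀ k, Real.exp (-t * φ.eval x) ^ k ≤ 1 := fun x hx k =>
      pow_le_one₀ (Real.exp_pos _).le (Real.exp_le_one_iff.mpr (by nlinarith))
    have hmem : MemLp (fun x => w.eval x * φ.eval x ^ m * Real.exp (-t * φ.eval x) ^ (k + 1))
        r μ := by
      refine (hpol (w * φ ^ m)).mono (by fun_prop) ?_
      filter_upwards [hφ] with x hx
      simp only [Real.norm_eq_abs, abs_mul, abs_pow, Real.abs_exp, eval_mul, eval_pow]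
      exact mul_le_of_le_one_right (by positivity) (hle x hx _)
    refine of_dominated hr hr' hpol (u := fun N x => ∑ j ∈ Finset.range N,
      ((-t) ^ j / (j.factorial : ℝ)) *
        (w.eval x * φ.eval x ^ (m + j) * Real.exp (-t * φ.eval x) ^ k))
      (D := fun x => |w.eval x * φ.eval x ^ m * Real.exp (t * φ.eval x)|)
      (fun N => sum hr hpol _ _ _ fun j _ => ih (m + j)) hmem
      (memLp_mul_exp hφ ht hexp m).abs (fun N => ?_) (ae_of_all _ fun x => ?_)
    · filter_upwards [hφ] with x hx
      have h1 : ∑ j ∈ Finset.range N, ((-t) ^ j / (j.factorial : ℝ)) *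
          (w.eval x * φ.eval x ^ (m + j) * Real.exp (-t * φ.eval x) ^ k)
          = (w.eval x * φ.eval x ^ m * Real.exp (-t * φ.eval x) ^ k)
            * ∑ j ∈ Finset.range N, (-t * φ.eval x) ^ j / (j.factorial : ℝ) := by
        rw [Finset.mul_sum]
        refine Finset.sum_congr rfl fun j _ => ?_
        rw [mul_pow, pow_add]; ring
      have h2 : |∑ j ∈ Finset.range N, (-t * φ.eval x) ^ j / (j.factorial : ℝ)|
          ≤ Real.exp (t * φ.eval x) := by
        refine (Finset.abs_sum_le_sum_abs _ _).trans
          (le_trans (le_of_eq ?_) (Real.sum_le_exp_of_nonneg (by positivity) N))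
        refine Finset.sum_congr rfl fun j _ => ?_
        rw [abs_div, abs_pow, abs_mul, abs_neg, abs_of_pos ht, abs_of_nonneg hx,
          abs_of_nonneg (by positivity : (0 : ℝ) ≤ (j.factorial : ℝ))]
      rw [h1, abs_mul, abs_mul, abs_mul (w.eval x * φ.eval x ^ m) (Real.exp _), Real.abs_exp]
      have h3 : |Real.exp (-t * φ.eval x) ^ k| ≤ 1 := by
        rw [abs_of_nonneg (by positivity)]; exact hle x hx k
      calc _ ≤ |w.eval x * φ.eval x ^ m| * 1 * Real.exp (t * φ.eval x) := by gcongr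
        _ = _ := by ring
    · have h1 : Tendsto (fun N => (w.eval x * φ.eval x ^ m * Real.exp (-t * φ.eval x) ^ k)
          * ∑ j ∈ Finset.range N, (-t * φ.eval x) ^ j / (j.factorial : ℝ)) atTop
          (𝓝 ((w.eval x * φ.eval x ^ m * Real.exp (-t * φ.eval x) ^ k)
            * Real.exp (-t * φ.eval x))) := by
        refine Tendsto.const_mul _ ?_
        have := (NormedSpace.expSeries_div_hasSum_exp (-t * φ.eval x)).tendsto_sum_nat
        rwa [← Real.exp_eq_exp_ℝ] at this
      rw [pow_succ, ← mul_assoc]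
      refine h1.congr fun N => ?_
      rw [Finset.mul_sum]
      refine Finset.sum_congr rfl fun j _ => ?_
      rw [mul_pow, pow_add]; ring

/-- If `w exp(2tφ) ∈ L^r(μ)`, then `w F(φ)` is a limit of polynomials for continuous compactly
supported `F`. -/
lemma mul_comp (hr : 1 ≤ r) (hr' : r ≠ ∞)
    (hpol : ∀ q : ℝ[X], MemLp (fun x => q.eval x) r μ) (hφ : ∀ᵐ x ∂μ, 0 ≤ φ.eval x) (ht : 0 < t)
    (hexp : MemLp (fun x => w.eval x * Real.exp (2 * t * φ.eval x)) r μ) {F : ℝ → ℝ}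
    (hF : Continuous F) {R : ℝ} (hFR : ∀ y, R ≤ y → F y = 0) (hFb : ∃ B, ∀ y, |F y| ≤ B) :
    PolyApprox μ r fun x => w.eval x * F (φ.eval x) := by
  obtain ⟨B, hB⟩ := hFb
  have hmem : MemLp (fun x => w.eval x * F (φ.eval x)) r μ := by
    refine ((hpol w).const_mul B).mono (by fun_prop) (ae_of_all _ fun x => ?_)
    rw [norm_mul, norm_mul, mul_comm]
    gcongr
    exact (hB _).trans (le_abs_self B)
  refine of_approx hmem hr (fun ε hε => ?_) hpol
  -- A uniform error `δ` in approximating `F(φ)` costs `δ ‖w‖_r`.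
  obtain ⟨δ, hδ, hδε⟩ : ∃ δ : ℝ, 0 < δ ∧
      ENNReal.ofReal δ * eLpNorm (fun x => w.eval x) r μ ≤ ε := by
    rcases eq_or_ne ε ∞ with rfl | hε'
    · exact ⟨1, one_pos, le_top⟩
    · have hM := (hpol w).2.ne
      set M := (eLpNorm (fun x => w.eval x) r μ).toReal with hMdef
      have hM0 : 0 ≤ M := ENNReal.toReal_nonneg
      refine ⟨ε.toReal / (M + 1), div_pos (ENNReal.toReal_pos hε hε') (by positivity), ?_⟩
      rw [← ENNReal.ofReal_toReal hM, ← hMdef, ← ENNReal.ofReal_mul (by positivity)]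
      refine ENNReal.ofReal_le_of_le_toReal ?_
      rw [div_mul_eq_mul_div, div_le_iff₀ (by positivity)]
      have := ENNReal.toReal_nonneg (a := ε)
      nlinarith
  set η := Real.exp (-t * R) with hη
  have hη0 : 0 < η := Real.exp_pos _
  -- In the variable `u = e^(-tφ)`, which lies in `[0, 1]`, the function `F(φ)` becomes accessible
  -- to Weierstrass. Cutting off at `η = e^(-tR)` avoids the singularity of the logarithm at `0` and
  -- changes nothing, as `F` vanishes from `R` on.
  have hcont : Continuous fun u : ℝ => F (-Real.log (max u η) / t) := by
    refine hF.comp (Continuous.div_const (Continuous.neg (Continuous.log (by fun_prop)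
      fun u => ?_)) t)
    exact (lt_max_of_lt_right hη0).ne'
  obtain ⟨Q, hQ⟩ := exists_polynomial_near_of_continuousOn 0 1 _ hcont.continuousOn δ hδ
  refine ⟨fun x => w.eval x * Q.eval (Real.exp (-t * φ.eval x)), ?_, ?_⟩
  · have h1 := sum hr hpol (Finset.range (Q.natDegree + 1)) (fun k => Q.coeff k)
      (fun k x => w.eval x * φ.eval x ^ 0 * Real.exp (-t * φ.eval x) ^ k)
      (fun k _ => mul_exp_neg hr hr' hpol hφ ht hexp k 0)
    convert h1 using 2 with x
    rw [eval_eq_sum_range (p := Q), Finset.mul_sum]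
    refine Finset.sum_congr rfl fun k _ => ?_
    ring
  · refine le_trans ?_ hδε
    refine (eLpNorm_le_mul_eLpNorm_of_ae_le_mul ?_ r)
    filter_upwards [hφ] with x hx
    rw [← mul_sub, norm_mul, mul_comm]
    gcongr
    have h1 := hQ (Real.exp (-t * φ.eval x)) ⟨(Real.exp_pos _).le,
      Real.exp_le_one_iff.mpr (by nlinarith)⟩
    have h2 : F (-Real.log (max (Real.exp (-t * φ.eval x)) η) / t) = F (φ.eval x) := by
      rcases le_total (φ.eval x) R with h | h
      · rw [max_eq_left (Real.exp_le_exp.mpr (by nlinarith)), Real.log_exp]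
        congr 1; field_simp
      · rw [max_eq_right (Real.exp_le_exp.mpr (by nlinarith)), Real.log_exp, hFR _ h]
        refine hFR _ (le_of_eq ?_)
        field_simp
    rw [h2, abs_sub_comm] at h1
    exact h1.le

end ExpMoment

end PolyApprox

/-- Continuous functions with compact support are dense in `L^r`, so only these have to be
approximated. -/
lemma polynomialDense_of_continuous {μ : Measure ℝ} [IsFiniteMeasure μ] {r : ℝ≥0∞} (hr : 1 ≤ r)
    (hr' : r ≠ ∞) (hpol : ∀ q : ℝ[X], MemLp (fun x => q.eval x) r μ)
    (h : ∀ g : ℝ → ℝ, Continuous g → ∀ R B : ℝ, 0 ≤ R → (∀ x, R ≤ |x| → g x = 0) →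
      (∀ x, |g x| ≤ B) → PolyApprox μ r g) : PolynomialDense μ r := by
  intro f hf
  refine (PolyApprox.of_approx hf hr (fun ε hε => ?_) hpol).2
  obtain ⟨g, hg, hfg, hgc, -⟩ := hf.exists_hasCompactSupport_eLpNorm_sub_le hr' hε
  obtain ⟨B, hB⟩ := hg.exists_bound_of_continuous hgc
  obtain ⟨R, hR⟩ := hg.isCompact.isBounded.subset_closedBall 0
  refine ⟨g, h g hgc (max R 0 + 1) B (by positivity) (fun x hx => ?_) hB, hfg⟩
  by_contra hgx
  have h1 := hR (subset_tsupport g hgx)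
  rw [mem_closedBall_zero_iff, Real.norm_eq_abs] at h1
  linarith [le_max_left R 0]

/-- Polynomials are dense in `L^r` of a finite measure on `[0, ∞)` with an exponential moment. -/
lemma polynomialDense_of_exp_moment {μ : Measure ℝ} [IsFiniteMeasure μ] {r : ℝ≥0∞} (hr : 1 ≤ r)
    (hr' : r ≠ ∞) (hpol : ∀ q : ℝ[X], MemLp (fun x => q.eval x) r μ)
    (hpos : ∀ᵐ x ∂μ, 0 ≤ x) {t : ℝ} (ht : 0 < t)
    (hexp : MemLp (fun x => Real.exp (2 * t * x)) r μ) : PolynomialDense μ r := by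
  refine polynomialDense_of_continuous hr hr' hpol fun g hg R B hR hgR hgB => ?_
  have h1 := PolyApprox.mul_comp (φ := X) (w := 1) hr hr' hpol (by simpa using hpos) ht
    (by simpa using hexp) hg (R := R) (fun y hy => hgR y (hy.trans (le_abs_self y))) ⟨B, hgB⟩
  simpa using h1

/-- Polynomials are dense in `L^r` of a finite measure on `ℝ` with a square exponential moment. -/
lemma polynomialDense_of_exp_sq_moment {μ : Measure ℝ} [IsFiniteMeasure μ] {r : ℝ≥0∞}
    (hr : 1 ≤ r) (hr' : r ≠ ∞) (hpol : ∀ q : ℝ[X], MemLp (fun x => q.eval x) r μ)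
    {t : ℝ} (ht : 0 < t) (hexp : MemLp (fun x => Real.exp (2 * t * x ^ 2)) r μ)
    (hexp' : MemLp (fun x => x * Real.exp (2 * t * x ^ 2)) r μ) : PolynomialDense μ r := by
  refine polynomialDense_of_continuous hr hr' hpol fun g hg R B hR hgR hgB => ?_
  have hφ : ∀ᵐ x ∂μ, 0 ≤ (X ^ 2 : ℝ[X]).eval x := ae_of_all _ fun x => by simp [sq_nonneg]
  have hsqrt : ∀ y, R ^ 2 ≤ y → R ≤ |√y| := fun y hy => by
    rw [abs_of_nonneg (Real.sqrt_nonneg y)]; exact Real.le_sqrt_of_sq_le hy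
  -- The even part of `g` is a continuous function of `φ = x²`, with `w = 1`.
  have heven : PolyApprox μ r fun x => (g x + g (-x)) / 2 := by
    have h1 := PolyApprox.mul_comp (φ := X ^ 2) (w := 1) hr hr' hpol hφ ht
      (by simpa using hexp) (F := fun y => (g √y + g (-√y)) / 2) (R := R ^ 2)
      (by fun_prop) (fun y hy => by
        rw [hgR _ (hsqrt y hy), hgR (-√y) (by rw [abs_neg]; exact hsqrt y hy)]; simp)
      ⟨B, fun y => by
        rw [abs_div, abs_two, div_le_iff₀ two_pos]
        linarith [abs_add_le (g √y) (g (-√y)), hgB √y, hgB (-√y)]⟩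
    convert h1 using 2 with x
    simp only [eval_one, eval_pow, eval_X, one_mul, Real.sqrt_sq_eq_abs]
    rcases abs_cases x with ⟨h, -⟩ | ⟨h, -⟩ <;> rw [h]
    rw [neg_neg, add_comm]
  have hdiff : ∀ x, |(g x - g (-x)) / 2| ≤ B := fun x => by
    rw [abs_div, abs_two, div_le_iff₀ two_pos]
    linarith [abs_sub (g x) (g (-x)), hgB x, hgB (-x)]
  have hB0 : 0 ≤ B := (abs_nonneg _).trans (hgB 0)
  -- The odd part would be `x` times a function of `x²` that may be singular at `0`. The factor `x²
  -- / (x² + 1/(n+1))` regularizes it, and then `w = x` applies; as `n → ∞` the factor tends to `1`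
  -- off the origin, where the odd part vanishes anyway.
  have hodd : PolyApprox μ r fun x => (g x - g (-x)) / 2 := by
    have h1 : ∀ n : ℕ, PolyApprox μ r
        fun x => (g x - g (-x)) / 2 * (x ^ 2 / (x ^ 2 + 1 / ((n : ℝ) + 1))) := by
      intro n
      have hn : (0 : ℝ) < 1 / ((n : ℝ) + 1) := by positivity
      have h1 := PolyApprox.mul_comp (φ := X ^ 2) (w := X) hr hr' hpol hφ ht
        (by simpa using hexp')
        (F := fun y => (g √y - g (-√y)) / 2 * (√y / (|y| + 1 / ((n : ℝ) + 1)))) (R := R ^ 2)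
        (by
          refine Continuous.mul (by fun_prop) (Continuous.div (by fun_prop) (by fun_prop) ?_)
          intro y; positivity) (fun y hy => by
          rw [hgR _ (hsqrt y hy), hgR (-√y) (by rw [abs_neg]; exact hsqrt y hy)]; simp)
        ⟨B * (((n : ℝ) + 1) + 1), fun y => by
          rw [abs_mul]
          refine mul_le_mul (hdiff _) ?_ (abs_nonneg _) hB0
          rw [abs_of_nonneg (by positivity), div_le_iff₀ (by positivity)]
          have h2 : √y ≤ 1 + |y| := by
            refine Real.sqrt_le_iff.mpr ⟨by positivity, ?_⟩
            nlinarith [abs_nonneg y, le_abs_self y]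
          have h3 : ((n : ℝ) + 1 + 1) * (1 / ((n : ℝ) + 1)) = 1 + 1 / ((n : ℝ) + 1) := by
            field_simp
          have h4 : 0 ≤ (n : ℝ) * |y| := by positivity
          nlinarith [abs_nonneg y]⟩
      convert h1 using 2 with x
      simp only [eval_pow, eval_X, Real.sqrt_sq_eq_abs, abs_of_nonneg (sq_nonneg x)]
      rcases abs_cases x with ⟨h, -⟩ | ⟨h, -⟩ <;> rw [h]
      · ring
      · rw [neg_neg]; ring
    refine PolyApprox.of_dominated hr hr' hpol h1 (D := fun _ => B) ?_ (memLp_const B)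
      (fun n => ae_of_all _ fun x => ?_) (ae_of_all _ fun x => ?_)
    · exact (memLp_const B).mono (by fun_prop) (ae_of_all _ fun x => by
        simpa only [Real.norm_eq_abs] using (hdiff x).trans (le_abs_self B))
    · rw [abs_mul]
      refine (mul_le_of_le_one_right (abs_nonneg _) ?_).trans (hdiff x)
      have hn : (0 : ℝ) < 1 / ((n : ℝ) + 1) := by positivity
      rw [abs_of_nonneg (by positivity), div_le_one (by positivity)]
      linarith
    · rcases eq_or_ne x 0 with rfl | hx
      · simp
      · have h2 : Tendsto (fun n : ℕ => x ^ 2 / (x ^ 2 + 1 / ((n : ℝ) + 1))) atTop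
            (𝓝 (x ^ 2 / (x ^ 2 + 0))) :=
          tendsto_const_nhds.div (tendsto_const_nhds.add tendsto_one_div_add_atTop_nhds_zero_nat)
            (by positivity)
        rw [add_zero, div_self (by positivity)] at h2
        simpa using h2.const_mul ((g x - g (-x)) / 2)
  have := heven.add hodd hr hpol
  convert this using 2 with x
  ring

/-! ### Passage to the limit along rescaled systems -/

lemma tendsto_eval_of_tendsto_coeff {q : ℕ → ℝ[X]} {q₀ : ℝ[X]} {n : ℕ}
    (hq : ∀ i, (q i).natDegree ≤ n) (hq₀ : q₀.natDegree ≤ n)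
    (h : ∀ j, Tendsto (fun i => (q i).coeff j) atTop (𝓝 (q₀.coeff j))) (y : ℝ) :
    Tendsto (fun i => (q i).eval y) atTop (𝓝 (q₀.eval y)) := by
  rw [eval_eq_sum_range' (Nat.lt_succ_of_le hq₀)]
  simp_rw [fun i => eval_eq_sum_range' (Nat.lt_succ_of_le (hq i)) y]
  exact tendsto_finsetSum _ fun j _ => (h j).mul_const _

/-- Convergent coefficients are bounded, and `|y|^j ≤ (1 + y²)^j` makes the bound a polynomial in
`y` itself rather than in `|y|`. -/
lemma exists_polynomial_bound {q : ℕ → ℝ[X]} {q₀ : ℝ[X]} {n : ℕ}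
    (hq : ∀ i, (q i).natDegree ≤ n)
    (h : ∀ j, Tendsto (fun i => (q i).coeff j) atTop (𝓝 (q₀.coeff j))) :
    ∃ Q : ℝ[X], ∀ i y, |(q i).eval y| ≤ Q.eval y := by
  have h1 : ∀ j, ∃ M : ℝ, ∀ i, |(q i).coeff j| ≤ M := fun j => by
    obtain ⟨M, hM⟩ := (h j).abs.bddAbove_range
    exact ⟨M, fun i => hM ⟨i, rfl⟩⟩
  choose M hM using h1
  refine ⟨∑ j ∈ Finset.range (n + 1), C (M j) * (1 + X ^ 2) ^ j, fun i y => ?_⟩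
  rw [eval_eq_sum_range' (Nat.lt_succ_of_le (hq i)), eval_finsetSum]
  refine (Finset.abs_sum_le_sum_abs _ _).trans (Finset.sum_le_sum fun j _ => ?_)
  rw [abs_mul, abs_pow]
  simp only [eval_mul, eval_C, eval_pow, eval_add, eval_one, eval_X]
  have h2 : |y| ≤ 1 + y ^ 2 := abs_le.mpr ⟨by nlinarith [sq_nonneg (y + 1)],
    by nlinarith [sq_nonneg (y - 1)]⟩
  exact mul_le_mul (hM j i) (pow_le_pow_left₀ (abs_nonneg _) h2 j) (by positivity)
    ((abs_nonneg _).trans (hM j i))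

lemma eLpNorm_le_mul_eLpNorm_iff {μ : Measure ℝ} {p : ℝ≥0∞} (hp : p ≠ 0) (hp' : p ≠ ∞)
    (f g : ℝ → ℝ) (K : ℝ≥0∞) :
    eLpNorm g p μ ≤ K * eLpNorm f p μ ↔
      ∫⁻ x, ‖g x‖ₑ ^ p.toReal ∂μ ≤ K ^ p.toReal * ∫⁻ x, ‖f x‖ₑ ^ p.toReal ∂μ := by
  have hr : 0 < p.toReal := ENNReal.toReal_pos hp hp'
  rw [← ENNReal.rpow_le_rpow_iff hr, ENNReal.mul_rpow_of_nonneg _ _ hr.le,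
    eLpNorm_eq_lintegral_rpow_enorm_toReal hp hp', eLpNorm_eq_lintegral_rpow_enorm_toReal hp hp',
    ← ENNReal.rpow_mul, ← ENNReal.rpow_mul, one_div, inv_mul_cancel₀ hr.ne', ENNReal.rpow_one,
    ENNReal.rpow_one]

/-- `μ` is, up to a constant factor, the image of `W(y) dy` under `φ`. -/
def HasWeight (μ : Measure ℝ) (φ W : ℝ → ℝ) : Prop :=
  ∃ K : ℝ≥0∞, K ≠ 0 ∧ K ≠ ∞ ∧ ∀ F : ℝ → ℝ≥0∞, Measurable F →
    ∫⁻ x, F x ∂μ = K * ∫⁻ y, F (φ y) * ENNReal.ofReal (W y)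

/-- The constant in `HasWeight` multiplies both sides and cancels. Hence no asymptotics of the Gamma
factors in the Jacobi measure are needed. -/
lemma HasWeight.eLpNorm_le_iff {μ : Measure ℝ} {φ W : ℝ → ℝ} (h : HasWeight μ φ W) {p : ℝ≥0∞}
    (hp : p ≠ 0) (hp' : p ≠ ∞) {f g : ℝ → ℝ} (hf : Measurable f) (hg : Measurable g) (B : ℝ≥0∞) :
    eLpNorm g p μ ≤ B * eLpNorm f p μ ↔
      ∫⁻ y, ‖g (φ y)‖ₑ ^ p.toReal * ENNReal.ofReal (W y)
        ≤ B ^ p.toReal * ∫⁻ y, ‖f (φ y)‖ₑ ^ p.toReal * ENNReal.ofReal (W y) := by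
  obtain ⟨K, hK0, hK, hF⟩ := h
  rw [eLpNorm_le_mul_eLpNorm_iff hp hp', hF _ (hf.enorm.pow_const _), hF _ (hg.enorm.pow_const _),
    mul_left_comm]
  exact ENNReal.mul_le_mul_iff_right hK0 hK

lemma measurable_polyComb (P : ℕ → ℝ[X]) (c : ℕ →₀ ℝ) : Measurable (polyComb P c) := by
  have : polyComb P c = fun x => (Finsupp.linearCombination ℝ P c).eval x :=
    funext fun x => polyComb_eq_eval P c x
  rw [this]
  fun_prop

lemma measurable_rieszComb (a : ℝ[X]) (ev : ℕ → ℝ) (P : ℕ → ℝ[X]) (c : ℕ →₀ ℝ) :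
    Measurable (rieszComb a ev P c) := by
  have : rieszComb a ev P c = fun x => ∑ k ∈ c.support, c k * rieszFun a ev P k x :=
    funext fun x => rieszComb_apply a ev P c x
  rw [this]
  exact Finset.measurable_fun_sum _ fun k _ => (RieszSystem.measurable_rieszFun k).const_mul _

/-- Norm inequalities pass to the limit along converging weights and functions. -/
lemma lintegral_le_of_tendsto {r : ℝ} (hr : 0 < r) {W : ℕ → ℝ → ℝ} {W₀ D : ℝ → ℝ}
    (hW : ∀ i, Measurable (W i)) (hlim : ∀ y, Tendsto (fun i => W i y) atTop (𝓝 (W₀ y)))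
    (hD : ∀ i y, W i y ≤ D y) {f g : ℕ → ℝ → ℝ} {f₀ g₀ Q : ℝ → ℝ} (hf : ∀ i, Measurable (f i))
    (hg : ∀ i, Measurable (g i)) (hQ : ∀ i y, |f i y| ≤ Q y)
    (hQD : ∫⁻ y, ‖Q y‖ₑ ^ r * ENNReal.ofReal (D y) ≠ ∞)
    (hflim : ∀ y, Tendsto (fun i => f i y) atTop (𝓝 (f₀ y)))
    (hglim : ∀ y, Tendsto (fun i => g i y) atTop (𝓝 (g₀ y))) {B : ℝ≥0∞} (hB : B ≠ ∞)
    (h : ∀ i, ∫⁻ y, ‖g i y‖ₑ ^ r * ENNReal.ofReal (W i y)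
      ≤ B * ∫⁻ y, ‖f i y‖ₑ ^ r * ENNReal.ofReal (W i y)) :
    ∫⁻ y, ‖g₀ y‖ₑ ^ r * ENNReal.ofReal (W₀ y)
      ≤ B * ∫⁻ y, ‖f₀ y‖ₑ ^ r * ENNReal.ofReal (W₀ y) := by
  have hWtop : ∀ y, Tendsto (fun i => ENNReal.ofReal (W i y)) atTop (𝓝 (ENNReal.ofReal (W₀ y))) :=
    fun y => (ENNReal.continuous_ofReal.tendsto _).comp (hlim y)
  have hpt : ∀ (u : ℕ → ℝ → ℝ) (u₀ : ℝ → ℝ),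
      (∀ y, Tendsto (fun i => u i y) atTop (𝓝 (u₀ y))) → ∀ y,
      Tendsto (fun i => ‖u i y‖ₑ ^ r * ENNReal.ofReal (W i y)) atTop
        (𝓝 (‖u₀ y‖ₑ ^ r * ENNReal.ofReal (W₀ y))) := fun u u₀ hu y =>
    ENNReal.Tendsto.mul ((ENNReal.continuous_rpow_const.tendsto _).comp (hu y).enorm)
      (Or.inr ENNReal.ofReal_ne_top) (hWtop y)
      (Or.inr (ENNReal.rpow_ne_top_of_nonneg hr.le enorm_ne_top))
  have h1 : Tendsto (fun i => ∫⁻ y, ‖f i y‖ₑ ^ r * ENNReal.ofReal (W i y)) atTop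
      (𝓝 (∫⁻ y, ‖f₀ y‖ₑ ^ r * ENNReal.ofReal (W₀ y))) := by
    refine tendsto_lintegral_of_dominated_convergence
      (fun y => ‖Q y‖ₑ ^ r * ENNReal.ofReal (D y))
      (fun i => ((hf i).enorm.pow_const _).mul (hW i).ennreal_ofReal)
      (fun i => ae_of_all _ fun y => ?_) hQD (ae_of_all _ (hpt f f₀ hflim))
    refine mul_le_mul' (ENNReal.rpow_le_rpow ?_ hr.le) (ENNReal.ofReal_le_ofReal (hD i y))
    rw [enorm_le_iff_norm_le, Real.norm_eq_abs, Real.norm_eq_abs]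
    exact (hQ i y).trans (le_abs_self _)
  -- Fatou's lemma suffices on this side, so the images `g i` need no majorant.
  calc ∫⁻ y, ‖g₀ y‖ₑ ^ r * ENNReal.ofReal (W₀ y)
      = ∫⁻ y, liminf (fun i => ‖g i y‖ₑ ^ r * ENNReal.ofReal (W i y)) atTop :=
        lintegral_congr fun y => (hpt g g₀ hglim y).liminf_eq.symm
    _ ≤ liminf (fun i => ∫⁻ y, ‖g i y‖ₑ ^ r * ENNReal.ofReal (W i y)) atTop :=
        lintegral_liminf_le fun i => ((hg i).enorm.pow_const _).mul (hW i).ennreal_ofReal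
    _ ≤ liminf (fun i => B * ∫⁻ y, ‖f i y‖ₑ ^ r * ENNReal.ofReal (W i y)) atTop :=
        liminf_le_liminf (Eventually.of_forall h)
    _ = B * ∫⁻ y, ‖f₀ y‖ₑ ^ r * ENNReal.ofReal (W₀ y) :=
        (ENNReal.Tendsto.const_mul h1 (Or.inr hB)).liminf_eq

/-- If rescalings of the systems `P i` converge to the system `P₀`, then norm inequalities for the
Riesz transforms of the `P i` carry over to `P₀`. -/
theorem eLpNorm_rieszComb_le_of_tendsto {p : ℝ≥0∞} (hp : p ≠ 0) (hp' : p ≠ ∞) {C₀ : ℝ}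
    {μ : ℕ → Measure ℝ} {μ₀ : Measure ℝ} {a : ℕ → ℝ[X]} {a₀ : ℝ[X]} {ev : ℕ → ℕ → ℝ} {ev₀ : ℕ → ℝ}
    {P : ℕ → ℕ → ℝ[X]} {P₀ : ℕ → ℝ[X]} {m s : ℕ → ℝ} {W : ℕ → ℝ → ℝ} {W₀ D : ℝ → ℝ}
    (hs : ∀ i, s i ≠ 0) (hμ : ∀ i, HasWeight (μ i) (fun y => m i + s i * y) (W i))
    (hμ₀ : HasWeight μ₀ (fun y => y) W₀)
    (hW : ∀ i, Measurable (W i)) (hlim : ∀ y, Tendsto (fun i => W i y) atTop (𝓝 (W₀ y)))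
    (hD : ∀ i y, W i y ≤ D y)
    (hmom : ∀ q : ℝ[X], ∫⁻ y, ‖q.eval y‖ₑ ^ p.toReal * ENNReal.ofReal (D y) ≠ ∞)
    (κ : ℕ → ℕ → ℝ) {R : ℕ → ℕ → ℝ[X]}
    (hR : ∀ i k, R i k = C (κ i k) * (P i k).comp (C (m i) + C (s i) * X))
    (hRdeg : ∀ i k, (R i k).natDegree ≤ k) (hPdeg : ∀ k, (P₀ k).natDegree ≤ k)
    (hcoeff : ∀ k j, Tendsto (fun i => (R i k).coeff j) atTop (𝓝 ((P₀ k).coeff j)))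
    {σ : ℝ} (hσ : |σ| = 1)
    (hρ : ∀ k y, Tendsto (fun i => √((a i).eval (m i + s i * y)) / (s i * √(ev i (k + 1)))) atTop
      (𝓝 (σ * (√(a₀.eval y) / √(ev₀ (k + 1))))))
    (h : ∀ i c, eLpNorm (rieszComb (a i) (ev i) (P i) c) p (μ i)
      ≤ ENNReal.ofReal C₀ * eLpNorm (polyComb (P i) c) p (μ i)) (c : ℕ →₀ ℝ) :
    eLpNorm (rieszComb a₀ ev₀ P₀ c) p μ₀ ≤ ENNReal.ofReal C₀ * eLpNorm (polyComb P₀ c) p μ₀ := by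
  have hr : 0 < p.toReal := ENNReal.toReal_pos hp hp'
  set n := c.support.sup id with hn
  have hkn : ∀ k ∈ c.support, k ≤ n := fun k hk => Finset.le_sup (f := id) hk
  -- The factors `κ i k` renormalize `P i k` so that the combination, read in the variable `y`,
  -- converges to the given combination of the `P₀ k`.
  let d : ℕ → ℕ →₀ ℝ := fun i => ∑ k ∈ c.support, Finsupp.single k (c k * κ i k)
  let q : ℕ → ℝ[X] := fun i => ∑ k ∈ c.support, C (c k) * R i k
  let q₀ : ℝ[X] := ∑ k ∈ c.support, C (c k) * P₀ k
  have hq : ∀ i y, polyComb (P i) (d i) (m i + s i * y) = (q i).eval y := fun i y => by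
    simp only [q, d, polyComb, map_sum, Finsupp.linearCombination_single, Finset.sum_apply,
      Pi.smul_apply, smul_eq_mul, eval_finsetSum, eval_mul, eval_C, hR, eval_comp, eval_add,
      eval_X, mul_assoc]
  have hq₀ : ∀ y, polyComb P₀ c y = q₀.eval y := fun y => by
    rw [polyComb_eq_eval]
    simp only [q₀, Finsupp.linearCombination_apply, Finsupp.sum, smul_eq_C_mul]
  have hqdeg : ∀ i, (q i).natDegree ≤ n := fun i =>
    natDegree_sum_le_of_forall_le _ _ fun k hk =>
      (natDegree_C_mul_le _ _).trans ((hRdeg i k).trans (hkn k hk))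
  have hq₀deg : q₀.natDegree ≤ n :=
    natDegree_sum_le_of_forall_le _ _ fun k hk =>
      (natDegree_C_mul_le _ _).trans ((hPdeg k).trans (hkn k hk))
  have hqcoeff : ∀ j, Tendsto (fun i => (q i).coeff j) atTop (𝓝 (q₀.coeff j)) := fun j => by
    simp only [q, q₀, finsetSum_coeff, coeff_C_mul]
    exact tendsto_finsetSum _ fun k _ => (hcoeff k j).const_mul _
  obtain ⟨Q, hQ⟩ := exists_polynomial_bound hqdeg hqcoeff
  have hder : ∀ i k y, (derivative (R i k)).eval y
      = κ i k * (s i * (derivative (P i k)).eval (m i + s i * y)) := fun i k y => by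
    simp [hR, derivative_comp]
  -- The chain rule produces a factor `s i` in the derivative of `R i k`, which the denominator
  -- compensates.
  have hg : ∀ i y, rieszComb (a i) (ev i) (P i) (d i) (m i + s i * y)
      = ∑ k ∈ c.support, c k * (√((a i).eval (m i + s i * y)) / (s i * √(ev i k))
        * (derivative (R i k)).eval y) := fun i y => by
    simp only [d, rieszComb, map_sum, Finsupp.linearCombination_single, Finset.sum_apply,
      Pi.smul_apply, smul_eq_mul, hder, rieszFun]
    refine Finset.sum_congr rfl fun k _ => ?_
    have := hs i
    rcases eq_or_ne (√(ev i k)) 0 with h0 | h0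
    · simp [h0]
    · field_simp
  have hglim : ∀ y, Tendsto (fun i => rieszComb (a i) (ev i) (P i) (d i) (m i + s i * y)) atTop
      (𝓝 (σ * rieszComb a₀ ev₀ P₀ c y)) := fun y => by
    simp_rw [hg, rieszComb_apply, Finset.mul_sum]
    refine tendsto_finsetSum _ fun k _ => ?_
    have h1 : Tendsto (fun i => (derivative (R i k)).eval y) atTop
        (𝓝 ((derivative (P₀ k)).eval y)) := by
      refine tendsto_eval_of_tendsto_coeff (n := k)
        (fun i => (natDegree_derivative_le _).trans ((Nat.sub_le _ _).trans (hRdeg i k)))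
        ((natDegree_derivative_le _).trans ((Nat.sub_le _ _).trans (hPdeg k))) (fun j => ?_) y
      simp only [coeff_derivative]
      exact (hcoeff k (j + 1)).mul_const _
    -- The factor `hρ` is controlled only for positive indices, as the eigenvalue at `0` may vanish;
    -- at index `0` the polynomials are constant and both images are zero.
    rcases k with - | k
    · have h2 : ∀ i, derivative (R i 0) = 0 := fun i => by
        rw [eq_C_of_natDegree_le_zero (hRdeg i 0), derivative_C]
      have h3 : derivative (P₀ 0) = 0 := by
        rw [eq_C_of_natDegree_le_zero (hPdeg 0), derivative_C]
      simp [h2, h3, rieszFun]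
    · have h2 := ((hρ k y).mul h1).const_mul (c (k + 1))
      convert h2 using 2
      simp only [rieszFun]; ring
  have key := lintegral_le_of_tendsto hr hW hlim hD (f := fun i y => (q i).eval y)
    (g := fun i y => rieszComb (a i) (ev i) (P i) (d i) (m i + s i * y)) (Q := fun y => Q.eval y)
    (fun i => (q i).continuous.measurable)
    (fun i => (measurable_rieszComb _ _ _ _).comp (by fun_prop)) hQ (hmom Q)
    (tendsto_eval_of_tendsto_coeff hqdeg hq₀deg hqcoeff) hglim
    (ENNReal.rpow_ne_top_of_nonneg hr.le (ENNReal.ofReal_ne_top (r := C₀))) (fun i => by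
      have h1 := ((hμ i).eLpNorm_le_iff hp hp' (measurable_polyComb _ _)
        (measurable_rieszComb _ _ _ _) _).mp (h i (d i))
      simpa only [hq] using h1)
  rw [hμ₀.eLpNorm_le_iff hp hp' (measurable_polyComb _ _) (measurable_rieszComb _ _ _ _)]
  have hσ' : ‖σ‖ₑ = 1 := by rw [← ofReal_norm, Real.norm_eq_abs, hσ, ENNReal.ofReal_one]
  simpa only [enorm_mul, hσ', one_mul, hq₀] using key

lemma lintegral_eq_mul_lintegral_affine (m : ℝ) {s : ℝ} (hs : s ≠ 0) {F : ℝ → ℝ≥0∞}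
    (hF : Measurable F) : ∫⁻ x, F x = ENNReal.ofReal |s| * ∫⁻ y, F (m + s * y) := by
  have h1 : ∫⁻ y, F (m + s * y) = ∫⁻ z, F (m + z) ∂(Measure.map (s * ·) volume) :=
    (lintegral_map (hF.comp (measurable_const_add m)) (measurable_const_mul s)).symm
  rw [h1, Real.map_volume_mul_left hs, lintegral_smul_measure,
    lintegral_add_left_eq_self F m, smul_eq_mul, ← mul_assoc,
    ← ENNReal.ofReal_mul (abs_nonneg s), ← abs_mul, mul_inv_cancel₀ hs]
  simp

lemma hasWeight_withDensity {g W : ℝ → ℝ} (hg : Measurable g) (m : ℝ) {s K : ℝ} (hs : s ≠ 0)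
    (hK : 0 < K) (h : ∀ y, g (m + s * y) = K * W y) :
    HasWeight (volume.withDensity fun x => ENNReal.ofReal (g x)) (fun y => m + s * y) W := by
  refine ⟨ENNReal.ofReal |s| * ENNReal.ofReal K, ?_, ?_, fun F hF => ?_⟩
  · simpa using ⟨hs, hK⟩
  · exact ENNReal.mul_ne_top ENNReal.ofReal_ne_top ENNReal.ofReal_ne_top
  · rw [lintegral_withDensity_eq_lintegral_mul _ hg.ennreal_ofReal hF,
      lintegral_eq_mul_lintegral_affine m hs (hg.ennreal_ofReal.mul hF), mul_assoc]
    congr 1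
    rw [← lintegral_const_mul' _ _ ENNReal.ofReal_ne_top]
    refine lintegral_congr fun y => ?_
    rw [Pi.mul_apply, h, ENNReal.ofReal_mul hK.le]
    ring

/-! ### Jacobi polynomials and the Jacobi measure -/

lemma ascPochhammer_eval_succ_left (k : ℕ) (x : ℝ) :
    (ascPochhammer ℝ (k + 1)).eval x = x * (ascPochhammer ℝ k).eval (x + 1) := by
  rw [ascPochhammer_succ_left]; simp

/-- The coefficients of the Jacobi polynomial at `(x - 1) / 2`. -/
noncomputable def jacobiCoeff (α β : ℝ) (n j : ℕ) : ℝ :=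
  (n.choose j : ℝ) / (n.factorial : ℝ) * (ascPochhammer ℝ j).eval (n + α + β + 1)
      * (ascPochhammer ℝ (n - j)).eval (α + j + 1)

/-- The Jacobi polynomial in the variable `(x - 1) / 2`. -/
noncomputable def jacobiShift (α β : ℝ) (n : ℕ) : ℝ[X] :=
  ∑ j ∈ Finset.range (n + 1), monomial j (jacobiCoeff α β n j)

/-- The Jacobi polynomial. -/
noncomputable def jacobiPoly (α β : ℝ) (n : ℕ) : ℝ[X] :=
  (jacobiShift α β n).comp (C (1 / 2) * (X - 1))

lemma jacobiPoly_eval (α β : ℝ) (n : ℕ) (x : ℝ) :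
    (jacobiPoly α β n).eval x = jacobiP α β n x := by
  simp only [jacobiPoly, jacobiShift, jacobiP, jacobiCoeff, eval_comp, eval_finsetSum,
    eval_monomial, eval_mul, eval_sub, eval_X, eval_one, eval_C]
  refine Finset.sum_congr rfl fun j _ => ?_
  congr 2
  ring

lemma coeff_jacobiShift (α β : ℝ) (n j : ℕ) :
    (jacobiShift α β n).coeff j = jacobiCoeff α β n j := by
  simp only [jacobiShift, finsetSum_coeff, coeff_monomial, Finset.sum_ite_eq', Finset.mem_range]
  split_ifs with h
  · rfl
  · simp [jacobiCoeff, Nat.choose_eq_zero_of_lt (by omega : n < j)]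

lemma natDegree_jacobiShift_le (α β : ℝ) (n : ℕ) : (jacobiShift α β n).natDegree ≤ n :=
  natDegree_sum_le_of_forall_le _ _ fun _ hj =>
    (natDegree_monomial_le _).trans (Nat.lt_succ_iff.mp (Finset.mem_range.mp hj))

/-- This is the hypergeometric recurrence of the expansion at `x = 1`. It holds for every `j`: for
`j = n` the factor `n - j` vanishes, and beyond that the binomial coefficients do. -/
lemma jacobiCoeff_succ (α β : ℝ) (n j : ℕ) :
    jacobiCoeff α β n (j + 1) * ((j + 1) * (j + α + 1))
      = jacobiCoeff α β n j * ((n - j) * (n + j + α + β + 1)) := by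
  rcases lt_trichotomy j n with h | rfl | h
  · have h1 : ((n.choose (j + 1) : ℕ) : ℝ) * (j + 1) = n.choose j * (n - j) := by
      have := congrArg (Nat.cast (R := ℝ)) (Nat.choose_succ_right_eq n j)
      push_cast [Nat.cast_sub h.le] at this
      exact this
    have h2 : (ascPochhammer ℝ (n - j)).eval (α + j + 1)
        = (α + j + 1) * (ascPochhammer ℝ (n - (j + 1))).eval (α + (j + 1 : ℕ) + 1) := by
      rw [show n - j = (n - (j + 1)) + 1 by omega, ascPochhammer_eval_succ_left]
      push_cast; ring_nf
    unfold jacobiCoeff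
    rw [ascPochhammer_succ_eval, h2]
    linear_combination (1 / (n.factorial : ℝ) * (ascPochhammer ℝ j).eval (n + α + β + 1)
      * (n + α + β + 1 + j) * (ascPochhammer ℝ (n - (j + 1))).eval (α + (j + 1 : ℕ) + 1)
      * (j + α + 1)) * h1
  · simp [jacobiCoeff]
  · simp [jacobiCoeff, Nat.choose_eq_zero_of_lt h, Nat.choose_eq_zero_of_lt (h.trans j.lt_succ_self)]

/-- Comparison of coefficients in the hypergeometric equation for `z = (x - 1)/2` is exactly
`jacobiCoeff_succ`. -/
lemma jacobiShift_ode (α β : ℝ) (n : ℕ) :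
    X * derivative (derivative (jacobiShift α β n))
      + X * (X * derivative (derivative (jacobiShift α β n)))
      + C (α + 1) * derivative (jacobiShift α β n)
      + C (α + β + 2) * (X * derivative (jacobiShift α β n))
      = C (n * (n + α + β + 1)) * jacobiShift α β n := by
  ext j
  have h := jacobiCoeff_succ α β n
  rcases j with - | - | j
  · have := h 0
    simp only [coeff_add, coeff_C_mul, coeff_X_mul_zero, coeff_derivative, coeff_jacobiShift]
    push_cast at this ⊢
    linear_combination this
  · have := h 1
    simp only [coeff_add, coeff_C_mul, coeff_X_mul, coeff_X_mul_zero, coeff_derivative,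
      coeff_jacobiShift, zero_add]
    push_cast at this ⊢
    linear_combination this
  · have := h (j + 2)
    simp only [coeff_add, coeff_C_mul, coeff_X_mul, coeff_derivative, coeff_jacobiShift]
    push_cast at this ⊢
    linear_combination this

lemma jacobiPoly_ode (α β : ℝ) (n : ℕ) :
    (1 - X ^ 2) * derivative (derivative (jacobiPoly α β n))
      + (C (β - α) - C (α + β + 2) * X) * derivative (jacobiPoly α β n)
      = -(C (n * (n + α + β + 1)) * jacobiPoly α β n) := by
  have h := congrArg (fun q => q.comp (C (1 / 2) * (X - 1))) (jacobiShift_ode α β n)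
  simp only [add_comp, mul_comp, X_comp, C_comp] at h
  have hX : (X : ℝ[X]) = C 2 * (C (1 / 2) * (X - 1)) + 1 := by
    rw [← mul_assoc, ← C_mul]; norm_num
  have hd : derivative (C (1 / 2) * (X - 1) : ℝ[X]) = C (1 / 2) := by simp
  simp only [jacobiPoly, derivative_comp, derivative_mul, hd, derivative_C, zero_mul, zero_add]
  set B := (jacobiShift α β n).comp (C (1 / 2) * (X - 1))
  set B' := (derivative (jacobiShift α β n)).comp (C (1 / 2) * (X - 1))
  set B'' := (derivative (derivative (jacobiShift α β n))).comp (C (1 / 2) * (X - 1))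
  rw [← h]
  have h4 : (C (1 / 2) : ℝ[X]) * C 2 = 1 := by rw [← C_mul]; norm_num
  have h2 : (C 2 : ℝ[X]) = 2 := rfl
  have h5 : (C (1 / 2) : ℝ[X]) * 2 = 1 := h4
  have e1 : (C (β - α) : ℝ[X]) = C β - C α := C_sub
  have e2 : (C (α + β + 2) : ℝ[X]) = C α + C β + 2 := by rw [C_add, C_add, h2]
  have e3 : (C (α + 1) : ℝ[X]) = C α + 1 := by rw [C_add, C_1]
  rw [e1, e2, e3]
  -- Only the relation `c * 2 = 1` matters from here on; with `L = (X - 1)/2` the claim becomes an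
  -- identity in commuting variables.
  generalize (C (1 / 2) : ℝ[X]) = c at *
  have hX' : (X : ℝ[X]) = 1 + 2 * (c * (X - 1)) := by linear_combination -(X - 1) * h5
  generalize hL : c * (X - 1) = L at *
  rw [hX']
  linear_combination (-(2 * c + 1) * (L + L ^ 2) * B''
    + (-(C α + 1) - (C α + C β + 2) * L) * B') * h5

/-- This identifies `√a P_k'` with the function `√(1 - x²) P_{k-1}^(α+1,β+1)` of the Riesz series,
including its factor `(k+α+β+1)/2`. -/
lemma derivative_jacobiPoly (α β : ℝ) (n : ℕ) :
    derivative (jacobiPoly α β (n + 1))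
      = C (((n + 1) + α + β + 1) / 2) * jacobiPoly (α + 1) (β + 1) n := by
  have h1 : derivative (jacobiShift α β (n + 1))
      = C ((n + 1) + α + β + 1) * jacobiShift (α + 1) (β + 1) n := by
    ext j
    rw [coeff_derivative, coeff_C_mul, coeff_jacobiShift, coeff_jacobiShift]
    have h2 : ((n + 1).choose (j + 1) : ℝ) * (j + 1) = (n + 1) * n.choose j := by
      have := Nat.add_one_mul_choose_eq n j
      exact_mod_cast this.symm
    have h3 : (((n + 1).factorial : ℕ) : ℝ) = (n + 1) * n.factorial := by
      rw [Nat.factorial_succ]; push_cast; ring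
    have h4 : (n.factorial : ℝ) ≠ 0 := by positivity
    have h5 : (n + 1 : ℝ) ≠ 0 := by positivity
    unfold jacobiCoeff
    rw [ascPochhammer_eval_succ_left, Nat.add_sub_add_right, h3]
    push_cast
    have h6 : (n + 1 + α + β + 1 + 1 : ℝ) = n + (α + 1) + (β + 1) + 1 := by ring
    have h7 : α + (j + 1) + 1 = α + 1 + j + 1 := by ring
    rw [h6, h7]
    field_simp
    linear_combination ((n + 1 + α + β + 1 : ℝ) *
      (ascPochhammer ℝ j).eval (n + (α + 1) + (β + 1) + 1) *
      (ascPochhammer ℝ (n - j)).eval (α + 1 + j + 1)) * h2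
  have hd : derivative (C (1 / 2) * (X - 1) : ℝ[X]) = C (1 / 2) := by simp
  rw [jacobiPoly, derivative_comp, hd, h1, mul_comp, C_comp, jacobiPoly, ← mul_assoc, ← C_mul]
  congr 2
  ring

/-- The value at `1` is `(α+1)_n / n!`, which is positive. -/
lemma jacobiPoly_ne_zero {α : ℝ} (hα : -1 < α) (β : ℝ) (n : ℕ) : jacobiPoly α β n ≠ 0 := by
  intro h
  have h1 := congrArg (eval 1) h
  rw [jacobiPoly, eval_comp] at h1
  simp only [eval_mul, eval_C, eval_sub, eval_X, eval_one, sub_self, mul_zero, eval_zero,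
    ← coeff_zero_eq_eval_zero, coeff_jacobiShift, jacobiCoeff] at h1
  have h2 := ascPochhammer_pos n (α + 1) (by linarith)
  simp only [Nat.choose_zero_right, Nat.cast_one, ascPochhammer_zero, eval_one, mul_one,
    Nat.sub_zero, Nat.cast_zero, add_zero] at h1
  exact (mul_pos (by positivity) h2).ne' h1

/-- The eigenvalues of the Jacobi operator. -/
noncomputable def jacobiEv (α β : ℝ) (k : ℕ) : ℝ := k * (k + α + β + 1)

lemma jacobiEv_pos {α β : ℝ} (hα : -1 < α) (hβ : -1 < β) (n : ℕ) : 0 < jacobiEv α β (n + 1) := by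
  unfold jacobiEv
  have : (0 : ℝ) ≤ n := n.cast_nonneg
  push_cast
  exact mul_pos (by positivity) (by linarith)

lemma jacobiEv_injective {α β : ℝ} (hα : -1 < α) (hβ : -1 < β) :
    Function.Injective (jacobiEv α β) := by
  refine (strictMono_nat_of_lt_succ fun n => ?_).injective
  unfold jacobiEv
  have : (0 : ℝ) ≤ n := n.cast_nonneg
  push_cast
  nlinarith

lemma isJacobiRiesz_iff (α β : ℝ) (f g : ℝ → ℝ) :
    IsJacobiRiesz α β f g ↔
      IsRiesz (jacobiMeasure α β) (1 - X ^ 2) (jacobiEv α β) (jacobiPoly α β) f g := by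
  unfold IsJacobiRiesz IsRiesz
  refine iff_of_eq ?_
  congr 1
  ext n x
  simp only [rieszFun, derivative_jacobiPoly, eval_mul, eval_C, jacobiPoly_eval, jacobiEv, eval_sub,
    eval_one, eval_pow, eval_X]
  push_cast
  ring

/-- The density of the Jacobi measure. -/
noncomputable def jacobiDensity (α β : ℝ) : ℝ → ℝ :=
  (Set.Ioo (-1 : ℝ) 1).indicator fun x =>
    Real.Gamma (α + β + 2) / (2 ^ (α + β + 1) * Real.Gamma (α + 1) * Real.Gamma (β + 1))
        * ((1 - x) ^ α * (1 + x) ^ β)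

lemma measurable_jacobiDensity (α β : ℝ) : Measurable (jacobiDensity α β) :=
  Measurable.indicator (by fun_prop) measurableSet_Ioo

lemma jacobiMeasure_eq (α β : ℝ) :
    jacobiMeasure α β = volume.withDensity fun x => ENNReal.ofReal (jacobiDensity α β x) := by
  rw [jacobiMeasure, ← withDensity_indicator measurableSet_Ioo]
  congr 1
  ext x
  by_cases hx : x ∈ Set.Ioo (-1 : ℝ) 1 <;> simp [jacobiDensity, hx]

lemma jacobiConst_pos {α β : ℝ} (hα : -1 < α) (hβ : -1 < β) :
    0 < Real.Gamma (α + β + 2) / (2 ^ (α + β + 1) * Real.Gamma (α + 1) * Real.Gamma (β + 1)) := by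
  have h1 := Real.Gamma_pos_of_pos (by linarith : 0 < α + β + 2)
  have h2 := Real.Gamma_pos_of_pos (by linarith : 0 < α + 1)
  have h3 := Real.Gamma_pos_of_pos (by linarith : 0 < β + 1)
  positivity

lemma jacobiDensity_nonneg {α β : ℝ} (hα : -1 < α) (hβ : -1 < β) (x : ℝ) :
    0 ≤ jacobiDensity α β x := by
  refine Set.indicator_nonneg (fun x hx => ?_) x
  have h1 : 0 < 1 - x := by linarith [hx.2]
  have h2 : 0 < 1 + x := by linarith [hx.1]
  have := jacobiConst_pos hα hβ
  positivity

/-- For `β ≥ 0`, which is enough for large parameters, the factor `(1+x)^β` is bounded and only the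
endpoint `1` can be singular. -/
lemma integrable_jacobiDensity {α β : ℝ} (hα : -1 < α) (hβ : 0 ≤ β) :
    Integrable (jacobiDensity α β) := by
  rw [jacobiDensity, integrable_indicator_iff measurableSet_Ioo]
  refine Integrable.const_mul ?_ _
  have h1 : IntegrableOn (fun x : ℝ => (1 - x) ^ α) (Set.Ioo (-1) 1) := by
    have h2 := (intervalIntegral.intervalIntegrable_rpow' hα (a := 2) (b := 0)).comp_sub_left 1
    rw [intervalIntegrable_iff_integrableOn_Ioc_of_le (by norm_num)] at h2
    refine h2.mono_set fun x hx => ⟨by norm_num; exact hx.1, by norm_num; exact hx.2.le⟩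
  refine Integrable.mono (h1.const_mul (2 ^ β)) (by fun_prop) ?_
  refine (ae_restrict_iff' measurableSet_Ioo).mpr (ae_of_all _ fun x hx => ?_)
  have h3 : 0 < 1 - x := by linarith [hx.2]
  have h4 : 0 < 1 + x := by linarith [hx.1]
  rw [norm_mul, norm_mul, mul_comm]
  refine mul_le_mul_of_nonneg_right ?_ (norm_nonneg _)
  rw [Real.norm_eq_abs, Real.norm_eq_abs, abs_of_nonneg (by positivity),
    abs_of_nonneg (by positivity)]
  exact Real.rpow_le_rpow h4.le (by linarith [hx.2]) hβ

lemma isFiniteMeasure_jacobiMeasure {α β : ℝ} (hα : -1 < α) (hβ : 0 ≤ β) :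
    IsFiniteMeasure (jacobiMeasure α β) := by
  rw [jacobiMeasure_eq]
  exact isFiniteMeasure_withDensity_ofReal (integrable_jacobiDensity hα hβ).2

lemma jacobiMeasure_ne_zero {α β : ℝ} (hα : -1 < α) (hβ : -1 < β) :
    NeZero (jacobiMeasure α β) := by
  refine ⟨fun h => ?_⟩
  rw [jacobiMeasure_eq,
    withDensity_eq_zero_iff (measurable_jacobiDensity α β).ennreal_ofReal.aemeasurable] at h
  have h1 : volume (Set.Ioo (-1 : ℝ) 1) = 0 := by
    refine measure_mono_null (fun x hx => ?_) h
    have h1 : 0 < 1 - x := by linarith [hx.2]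
    have h2 : 0 < 1 + x := by linarith [hx.1]
    have := jacobiConst_pos hα hβ
    simp only [Set.mem_compl_iff, Set.mem_ofPred_eq, Pi.zero_apply, ENNReal.ofReal_eq_zero, not_le,
      jacobiDensity, Set.indicator_of_mem hx]
    positivity
  rw [Real.volume_Ioo, ENNReal.ofReal_eq_zero] at h1
  norm_num at h1

lemma ae_mem_Ioo_jacobiMeasure (α β : ℝ) : ∀ᵐ x ∂jacobiMeasure α β, x ∈ Set.Ioo (-1 : ℝ) 1 :=
  (withDensity_absolutelyContinuous _ _).ae_le (ae_restrict_mem measurableSet_Ioo)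

lemma memLp_eval_jacobiMeasure {α β : ℝ} (hα : -1 < α) (hβ : 0 ≤ β) (q : ℝ[X]) (r : ℝ≥0∞) :
    MemLp (fun x => q.eval x) r (jacobiMeasure α β) := by
  have := isFiniteMeasure_jacobiMeasure hα hβ
  obtain ⟨M, hM⟩ := (isCompact_Icc (a := (-1 : ℝ)) (b := 1)).exists_bound_of_continuousOn
    q.continuous.continuousOn
  refine MemLp.of_bound q.continuous.aestronglyMeasurable M ?_
  filter_upwards [ae_mem_Ioo_jacobiMeasure α β] with x hx
  exact hM x ⟨hx.1.le, hx.2.le⟩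

lemma integral_jacobiMeasure {α β : ℝ} (hα : -1 < α) (hβ : -1 < β) (f : ℝ → ℝ) :
    ∫ x, f x ∂jacobiMeasure α β = ∫ x, jacobiDensity α β x * f x := by
  rw [jacobiMeasure_eq, integral_withDensity_eq_integral_toReal_smul
    (measurable_jacobiDensity α β).ennreal_ofReal (ae_of_all _ fun _ => ENNReal.ofReal_lt_top)]
  simp_rw [ENNReal.toReal_ofReal (jacobiDensity_nonneg hα hβ _), smul_eq_mul]

/-- The Pearson equation of the Jacobi measure. -/
lemma integral_jacobiMeasure_pearson {α β : ℝ} (hα : -1 < α) (hβ : 0 ≤ β) (q : ℝ[X]) :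
    ∫ x, ((1 - X ^ 2) * derivative q + (C (β - α) - C (α + β + 2) * X) * q).eval x
      ∂jacobiMeasure α β = 0 := by
  have hβ' : -1 < β := by linarith
  set b := ((1 - X ^ 2) * derivative q + (C (β - α) - C (α + β + 2) * X) * q) with hb
  rw [integral_jacobiMeasure hα hβ']
  have hint : Integrable fun x => jacobiDensity α β x * b.eval x := by
    have h1 := memLp_one_iff_integrable.mp (memLp_eval_jacobiMeasure hα hβ b 1)
    rw [jacobiMeasure_eq, integrable_withDensity_iff_integrable_smul'
      (measurable_jacobiDensity α β).ennreal_ofReal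
      (ae_of_all _ fun _ => ENNReal.ofReal_lt_top)] at h1
    simpa only [ENNReal.toReal_ofReal (jacobiDensity_nonneg hα hβ' _), smul_eq_mul] using h1
  set K := Real.Gamma (α + β + 2) / (2 ^ (α + β + 1) * Real.Gamma (α + 1) * Real.Gamma (β + 1))
  have hsupp : (fun x => jacobiDensity α β x * b.eval x) = (Set.Ioo (-1 : ℝ) 1).indicator
      fun x => K * ((1 - x) ^ α * (1 + x) ^ β) * b.eval x := by
    ext x
    by_cases hx : x ∈ Set.Ioo (-1 : ℝ) 1 <;> simp [jacobiDensity, hx, K]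
  rw [hsupp] at hint ⊢
  rw [integrable_indicator_iff measurableSet_Ioo] at hint
  rw [integral_indicator measurableSet_Ioo, ← integral_Ioc_eq_integral_Ioo,
    ← intervalIntegral.integral_of_le (by norm_num)]
  -- The antiderivative is `1 - x²` times the density times `q`; its exponents `α + 1` and `β + 1`
  -- are positive, so it vanishes at both endpoints.
  rw [intervalIntegral.integral_eq_sub_of_hasDerivAt_of_le
    (f := fun x => K * ((1 - x) ^ (α + 1) * (1 + x) ^ (β + 1) * q.eval x)) (by norm_num)
    (Continuous.continuousOn ?_) (fun x hx => ?_)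
    ((intervalIntegrable_iff_integrableOn_Ioo_of_le (by norm_num)).mpr hint)]
  · simp [Real.zero_rpow (by linarith : α + 1 ≠ 0), Real.zero_rpow (by linarith : β + 1 ≠ 0)]
  · refine continuous_const.mul ((Continuous.mul ?_ ?_).mul q.continuous)
    · exact (continuous_const.sub continuous_id).rpow_const fun x => Or.inr (by linarith)
    · exact (continuous_const.add continuous_id).rpow_const fun x => Or.inr (by linarith)
  · have h1 : 0 < 1 - x := by linarith [hx.2]
    have h2 : 0 < 1 + x := by linarith [hx.1]
    have d1 : HasDerivAt (fun y : ℝ => (1 - y) ^ (α + 1)) (-1 * (α + 1) * (1 - x) ^ (α + 1 - 1)) x :=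
      ((hasDerivAt_id x).const_sub 1).rpow_const (Or.inl h1.ne')
    have d2 : HasDerivAt (fun y : ℝ => (1 + y) ^ (β + 1)) (1 * (β + 1) * (1 + x) ^ (β + 1 - 1)) x :=
      ((hasDerivAt_id x).const_add 1).rpow_const (Or.inl h2.ne')
    refine (((d1.mul d2).mul (q.hasDerivAt x)).const_mul K).congr_deriv ?_
    rw [Pi.mul_apply, add_sub_cancel_right, add_sub_cancel_right, Real.rpow_add_one h1.ne',
      Real.rpow_add_one h2.ne', hb]
    simp only [eval_add, eval_mul, eval_sub, eval_one, eval_pow, eval_X, eval_C]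
    ring

/-- The Jacobi polynomials form a Riesz system. -/
lemma rieszSystem_jacobi {α β : ℝ} (hα : -1 < α) (hβ : 0 ≤ β) :
    RieszSystem (jacobiMeasure α β) (1 - X ^ 2) (jacobiEv α β) (jacobiPoly α β) := by
  have hβ' : -1 < β := by linarith
  have := jacobiMeasure_ne_zero hα hβ'
  refine RieszSystem.of_eigenfunctions (b := C (β - α) - C (α + β + 2) * X) ?_
    (fun q r _ => memLp_eval_jacobiMeasure hα hβ q r) ?_
    (integral_jacobiMeasure_pearson hα hβ) (fun n => jacobiPoly_ode α β n)
    (jacobiEv_injective hα hβ') (jacobiEv_pos hα hβ') ?_ (jacobiPoly_ne_zero hα β)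
  · rw [jacobiMeasure_eq]; exact withDensity_absolutelyContinuous _ _
  · filter_upwards [ae_mem_Ioo_jacobiMeasure α β] with x hx
    simp only [eval_sub, eval_one, eval_pow, eval_X]
    nlinarith [hx.1, hx.2]
  · simp [jacobiPoly, jacobiShift]

/-! ### Moments of weights with exponential decay -/

lemma exists_abs_eval_le_exp (q : ℝ[X]) {δ : ℝ} (hδ : 0 < δ) :
    ∃ M, 0 ≤ M ∧ ∀ y, |q.eval y| ≤ M * Real.exp (δ * |y|) := by
  refine ⟨∑ j ∈ Finset.range (q.natDegree + 1), |q.coeff j| * ((j.factorial : ℝ) / δ ^ j),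
    by positivity, fun y => ?_⟩
  rw [eval_eq_sum_range, Finset.sum_mul]
  refine (Finset.abs_sum_le_sum_abs _ _).trans (Finset.sum_le_sum fun j _ => ?_)
  rw [abs_mul, abs_pow, mul_assoc]
  refine mul_le_mul_of_nonneg_left ?_ (abs_nonneg _)
  have h1 := Real.pow_div_factorial_le_exp (δ * |y|) (by positivity) j
  rw [div_le_iff₀ (by positivity), mul_pow] at h1
  rw [div_mul_eq_mul_div, le_div_iff₀ (by positivity)]
  linarith

/-- A weight with an exponential moment integrates all powers of polynomials. -/
lemma lintegral_eval_rpow_ne_top (q : ℝ[X]) {r δ : ℝ} (hr : 0 < r) (hδ : 0 < δ) {D : ℝ → ℝ}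
    (hD : ∫⁻ y, ENNReal.ofReal (Real.exp (δ * |y|) * D y) ≠ ∞) :
    ∫⁻ y, ‖q.eval y‖ₑ ^ r * ENNReal.ofReal (D y) ≠ ∞ := by
  -- The rate `δ / r` becomes `δ` after taking the `r`-th power.
  obtain ⟨M, hM, hq⟩ := exists_abs_eval_le_exp q (δ := δ / r) (by positivity)
  refine ne_top_of_le_ne_top
    (ENNReal.mul_ne_top (ENNReal.ofReal_ne_top (r := M ^ r)) hD) ?_
  rw [← lintegral_const_mul' _ _ ENNReal.ofReal_ne_top]
  refine lintegral_mono fun y => ?_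
  rw [ENNReal.ofReal_mul (Real.exp_pos _).le, ← mul_assoc,
    ← ENNReal.ofReal_mul (by positivity)]
  refine mul_le_mul' ?_ le_rfl
  rw [← ofReal_norm, Real.norm_eq_abs, ENNReal.ofReal_rpow_of_nonneg (abs_nonneg _) hr.le]
  refine ENNReal.ofReal_le_ofReal ?_
  refine (Real.rpow_le_rpow (abs_nonneg _) (hq y) hr.le).trans (le_of_eq ?_)
  rw [Real.mul_rpow hM (Real.exp_pos _).le, ← Real.exp_mul]
  congr 2
  field_simp

lemma HasWeight.memLp {μ : Measure ℝ} {φ W : ℝ → ℝ} (h : HasWeight μ φ W) {r : ℝ≥0∞}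
    (hr : r ≠ 0) (hr' : r ≠ ∞) {f : ℝ → ℝ} (hf : Measurable f)
    (hfin : ∫⁻ y, ‖f (φ y)‖ₑ ^ r.toReal * ENNReal.ofReal (W y) ≠ ∞) : MemLp f r μ := by
  obtain ⟨K, -, hK, hF⟩ := h
  refine ⟨hf.aestronglyMeasurable, ?_⟩
  rw [eLpNorm_lt_top_iff_lintegral_rpow_enorm_lt_top hr hr', hF _ (hf.enorm.pow_const _)]
  exact ENNReal.mul_lt_top hK.lt_top hfin.lt_top

/-- From `|y| ≤ 1 + y²`, half of the Gaussian decay absorbs the exponential. -/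
lemma lintegral_exp_mul_gaussian_ne_top {b : ℝ} (hb : 0 < b) :
    ∫⁻ y, ENNReal.ofReal (Real.exp (b / 2 * |y|) * Real.exp (-b * y ^ 2)) ≠ ∞ := by
  have h1 := ((integrable_exp_neg_mul_sq (half_pos hb)).const_mul (Real.exp (b / 2))).lintegral_lt_top
  refine ne_top_of_le_ne_top h1.ne (lintegral_mono fun y => ENNReal.ofReal_le_ofReal ?_)
  rw [← Real.exp_add, ← Real.exp_add]
  refine Real.exp_le_exp.mpr ?_
  have h2 : |y| ≤ 1 + y ^ 2 := abs_le.mpr ⟨by nlinarith [sq_nonneg (y + 1)],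
    by nlinarith [sq_nonneg (y - 1)]⟩
  nlinarith

/-! ### Hermite polynomials and the Gaussian measure -/

/-- The Hermite polynomial. -/
noncomputable def hermitePoly (n : ℕ) : ℝ[X] :=
  C (√2 ^ n) * ((hermite n).map (Int.castRingHom ℝ)).comp (C √2 * X)

lemma hermitePoly_eval (n : ℕ) (x : ℝ) : (hermitePoly n).eval x = hermiteH n x := by
  simp [hermitePoly, hermiteH, aeval_def, eval₂_eq_eval_map]

lemma coeff_hermitePoly_self (n : ℕ) : (hermitePoly n).coeff n = 2 ^ n := by
  rw [hermitePoly, coeff_C_mul, comp_C_mul_X_coeff, coeff_map, coeff_hermite_self]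
  rw [map_one, one_mul, ← mul_pow, Real.mul_self_sqrt zero_le_two]

lemma coeff_hermitePoly_of_lt {n j : ℕ} (h : n < j) : (hermitePoly n).coeff j = 0 := by
  rw [hermitePoly, coeff_C_mul, comp_C_mul_X_coeff, coeff_map, coeff_hermite_of_lt h]
  simp

lemma natDegree_hermitePoly_le (n : ℕ) : (hermitePoly n).natDegree ≤ n :=
  natDegree_le_iff_coeff_eq_zero.mpr fun _ h => coeff_hermitePoly_of_lt h

lemma degree_hermitePoly (n : ℕ) : (hermitePoly n).degree = n :=
  degree_eq_of_le_of_coeff_ne_zero (natDegree_le_iff_degree_le.mp (natDegree_hermitePoly_le n))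
    (by rw [coeff_hermitePoly_self]; positivity)

lemma hermitePoly_succ (n : ℕ) :
    hermitePoly (n + 1) = C 2 * X * hermitePoly n - derivative (hermitePoly n) := by
  have h2 : (C √2 * C √2 : ℝ[X]) = C 2 := by rw [← C_mul, Real.mul_self_sqrt zero_le_two]
  simp only [hermitePoly, hermite_succ, Polynomial.map_sub, Polynomial.map_mul, map_X,
    ← derivative_map, sub_comp, mul_comp, X_comp, derivative_mul, derivative_C, zero_mul, zero_add,
    derivative_comp, derivative_X, mul_one, pow_succ, C_mul, ← h2]
  ring

lemma derivative_hermitePoly_succ (n : ℕ) :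
    derivative (hermitePoly (n + 1)) = C (2 * ((n : ℝ) + 1)) * hermitePoly n := by
  induction n with
  | zero =>
    have h2 : (C √2 * C √2 : ℝ[X]) = C 2 := by rw [← C_mul, Real.mul_self_sqrt zero_le_two]
    simp [hermitePoly, h2]
  | succ n ih =>
    rw [hermitePoly_succ (n + 1), derivative_sub, derivative_mul, ih, derivative_mul, derivative_C,
      zero_mul, zero_add]
    have h1 := hermitePoly_succ n
    have h3 : (C (2 * (((n + 1 : ℕ) : ℝ) + 1)) : ℝ[X]) = C (2 * ((n : ℝ) + 1)) + C 2 := by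
      rw [← C_add]; push_cast; congr 1; ring
    rw [h3, derivative_X, derivative_mul, derivative_C]
    linear_combination (-(C (2 * ((n : ℝ) + 1)))) * h1

/-- The eigenvalues of the Hermite operator. -/
noncomputable def hermiteEv (k : ℕ) : ℝ := 2 * k

lemma hermitePoly_ode (n : ℕ) :
    1 * derivative (derivative (hermitePoly n)) + (-(C 2 * X)) * derivative (hermitePoly n)
      = -(C (hermiteEv n) * hermitePoly n) := by
  rcases n with - | n
  · simp [hermitePoly, hermiteEv]
  · have h1 := hermitePoly_succ n
    have h2 : (hermiteEv (n + 1)) = 2 * (n + 1) := by simp [hermiteEv]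
    rw [derivative_hermitePoly_succ, derivative_mul, derivative_C, h2]
    linear_combination (C (2 * ((n : ℝ) + 1))) * h1

lemma isGaussianRiesz_iff (f g : ℝ → ℝ) :
    IsGaussianRiesz f g ↔ IsRiesz hermiteMeasure 1 hermiteEv hermitePoly f g := by
  unfold IsGaussianRiesz IsRiesz
  refine iff_of_eq ?_
  congr 1
  ext n x
  have h1 : (0 : ℝ) < 2 * (n + 1) := by positivity
  have h2 := Real.mul_self_sqrt h1.le
  have h3 := (Real.sqrt_pos.mpr h1).ne'
  simp only [rieszFun, derivative_hermitePoly_succ, eval_mul, eval_C, hermitePoly_eval, hermiteEv,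
    eval_one, Real.sqrt_one]
  push_cast
  field_simp
  rw [pow_two, h2]
  ring

lemma hermiteMeasure_eq : hermiteMeasure
    = volume.withDensity fun x => ENNReal.ofReal (gaussianPDFReal 0 (1 / 2) x) := by
  rw [hermiteMeasure, gaussianReal_of_var_ne_zero _ (by norm_num)]
  rfl

lemma gaussianPDFReal_half (x : ℝ) :
    gaussianPDFReal 0 (1 / 2) x = (√Real.pi)⁻¹ * Real.exp (-1 * x ^ 2) := by
  rw [gaussianPDFReal]
  congr 3
  · push_cast; ring
  · push_cast; ring

lemma hasWeight_hermiteMeasure :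
    HasWeight hermiteMeasure (fun y => y) fun y => Real.exp (-1 * y ^ 2) := by
  have h1 := hasWeight_withDensity (measurable_gaussianPDFReal 0 (1 / 2)) 0 one_ne_zero
    (K := (√Real.pi)⁻¹) (W := fun y => Real.exp (-1 * y ^ 2)) (by positivity)
    (fun y => by rw [zero_add, one_mul, gaussianPDFReal_half])
  rw [hermiteMeasure_eq]
  simpa only [zero_add, one_mul] using h1

/-- The `r`-th power of `e^(tx²)` only changes the Gaussian rate from `1` to `1 - tr`, which stays
positive. -/
lemma memLp_mul_exp_hermiteMeasure (q : ℝ[X]) {r : ℝ≥0∞} (hr : r ≠ 0) (hr' : r ≠ ∞) {t : ℝ}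
    (ht : t * r.toReal < 1) :
    MemLp (fun x => q.eval x * Real.exp (t * x ^ 2)) r hermiteMeasure := by
  have hr0 := ENNReal.toReal_pos hr hr'
  refine hasWeight_hermiteMeasure.memLp hr hr' (by fun_prop) ?_
  have h1 := lintegral_eval_rpow_ne_top q hr0 (half_pos (sub_pos.mpr ht))
    (lintegral_exp_mul_gaussian_ne_top (sub_pos.mpr ht))
  convert h1 using 3 with y
  rw [enorm_mul, ENNReal.mul_rpow_of_nonneg _ _ hr0.le, mul_assoc]
  congr 1
  rw [← ofReal_norm, Real.norm_eq_abs, Real.abs_exp,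
    ENNReal.ofReal_rpow_of_nonneg (Real.exp_pos _).le hr0.le,
    ← ENNReal.ofReal_mul (by positivity), ← Real.exp_mul, ← Real.exp_add]
  congr 2
  ring

lemma memLp_eval_hermiteMeasure (q : ℝ[X]) (r : ℝ≥0∞) (hr' : r ≠ ∞) :
    MemLp (fun x => q.eval x) r hermiteMeasure := by
  rcases eq_or_ne r 0 with rfl | hr
  · exact memLp_zero_iff_aestronglyMeasurable.mpr q.continuous.aestronglyMeasurable
  · simpa using memLp_mul_exp_hermiteMeasure q hr hr' (t := 0) (by simp)

instance isProbabilityMeasure_hermiteMeasure : IsProbabilityMeasure hermiteMeasure := by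
  unfold hermiteMeasure; infer_instance

lemma polynomialDense_hermiteMeasure {r : ℝ≥0∞} (hr : 1 ≤ r) (hr' : r ≠ ∞) :
    PolynomialDense hermiteMeasure r := by
  have hr0 := (zero_lt_one.trans_le hr).ne'
  have h0 := ENNReal.toReal_pos hr0 hr'
  -- With `t = 1/(4r)` the moment `e^(2tx²)` uses up half of the Gaussian rate.
  have h1 : 2 * (1 / (4 * r.toReal)) * r.toReal < 1 := by
    field_simp; norm_num
  refine polynomialDense_of_exp_sq_moment hr hr' (fun q => memLp_eval_hermiteMeasure q r hr')
    (t := 1 / (4 * r.toReal)) (by positivity) ?_ ?_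
  · simpa using memLp_mul_exp_hermiteMeasure 1 hr0 hr' h1
  · simpa using memLp_mul_exp_hermiteMeasure X hr0 hr' h1

/-- The Pearson equation of the Gaussian measure. -/
lemma integral_hermiteMeasure_pearson (q : ℝ[X]) :
    ∫ x, (1 * derivative q + (-(C 2 * X)) * q).eval x ∂hermiteMeasure = 0 := by
  have hint : ∀ q : ℝ[X], Integrable fun x => (√Real.pi)⁻¹ * Real.exp (-1 * x ^ 2) * q.eval x := by
    intro q
    have h1 := memLp_one_iff_integrable.mp (memLp_eval_hermiteMeasure q 1 ENNReal.one_ne_top)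
    rw [hermiteMeasure_eq, integrable_withDensity_iff_integrable_smul'
      (measurable_gaussianPDFReal _ _).ennreal_ofReal
      (ae_of_all _ fun _ => ENNReal.ofReal_lt_top)] at h1
    refine h1.congr (ae_of_all _ fun x => ?_)
    beta_reduce
    rw [ENNReal.toReal_ofReal (gaussianPDFReal_nonneg _ _ _), smul_eq_mul, gaussianPDFReal_half]
  rw [hermiteMeasure, integral_gaussianReal_eq_integral_smul (by norm_num)]
  simp only [gaussianPDFReal_half, smul_eq_mul]
  refine integral_eq_zero_of_hasDerivAt_of_integrable (fun x => ?_) (hint _) (hint q)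
  have h1 : HasDerivAt (fun y : ℝ => -1 * y ^ 2) (-1 * (2 * x)) x := by
    simpa using (hasDerivAt_pow 2 x).const_mul (-1)
  refine ((h1.exp.const_mul (√Real.pi)⁻¹).mul (q.hasDerivAt x)).congr_deriv ?_
  simp only [eval_add, eval_mul, eval_neg, eval_one, eval_X, eval_C]
  ring

/-- The Hermite polynomials form a Riesz system. -/
lemma rieszSystem_hermite : RieszSystem hermiteMeasure 1 hermiteEv hermitePoly := by
  refine RieszSystem.of_eigenfunctions (b := -(C 2 * X)) ?_ memLp_eval_hermiteMeasure (by simp)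
    integral_hermiteMeasure_pearson hermitePoly_ode ?_ ?_ (by simp [hermitePoly]) fun n h => ?_
  · exact gaussianReal_absolutelyContinuous _ (by norm_num)
  · intro m n h
    simpa [hermiteEv] using h
  · intro n; unfold hermiteEv; positivity
  · have := degree_hermitePoly n
    simp [h] at this

/-! ### The limit from ultraspherical to Hermite polynomials -/

/-- The recurrences below link the coefficients `j` and `j + 2`; knowing all `j ≥ n` starts the
descent in both parities. -/
lemma down_two_induction {n : ℕ} {p : ℕ → Prop} (h1 : ∀ j, n ≤ j → p j)
    (h2 : ∀ j, j < n → p (j + 2) → p j) (j : ℕ) : p j := by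
  have key : ∀ i j, n ≤ j + i → p j := by
    intro i
    induction i with
    | zero => exact h1
    | succ i ih =>
      intro j hj
      rcases lt_or_ge j n with h | h
      · exact h2 j h (ih _ (by omega))
      · exact h1 j h
  exact key n j (by omega)

lemma coeff_hermitePoly_succ_succ (n j : ℕ) :
    (j + 2) * (j + 1) * (hermitePoly n).coeff (j + 2)
      = -(2 * (n - j) * (hermitePoly n).coeff j) := by
  have h := congrArg (fun q => q.coeff j) (hermitePoly_ode n)
  rcases j with - | j
  · simp only [coeff_add, coeff_neg, one_mul, neg_mul, mul_assoc, coeff_C_mul, coeff_X_mul_zero,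
      coeff_derivative, hermiteEv] at h
    push_cast at h ⊢
    linear_combination h
  · simp only [coeff_add, coeff_neg, one_mul, neg_mul, mul_assoc, coeff_C_mul, coeff_X_mul,
      coeff_derivative, hermiteEv] at h
    push_cast at h ⊢
    linear_combination h

/-- For equal parameters the first-order coefficient of the differential equation has no constant
term, so comparing coefficients gives a recurrence of step two, parallel to the Hermite one. -/
lemma coeff_jacobiPoly_succ_succ (l : ℝ) (n j : ℕ) :
    (j + 2) * (j + 1) * (jacobiPoly (l - 1 / 2) (l - 1 / 2) n).coeff (j + 2)
      = -((n - j) * (n + j + 2 * l) * (jacobiPoly (l - 1 / 2) (l - 1 / 2) n).coeff j) := by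
  have h := congrArg (fun q => q.coeff j) (jacobiPoly_ode (l - 1 / 2) (l - 1 / 2) n)
  simp only [sub_self, C_0, zero_sub, neg_mul, sub_mul, one_mul, pow_two, mul_assoc] at h
  rcases j with - | - | j
  · simp only [coeff_add, coeff_sub, coeff_neg, coeff_C_mul, coeff_X_mul_zero,
      coeff_derivative] at h
    push_cast at h ⊢
    linear_combination h
  · simp only [coeff_add, coeff_sub, coeff_neg, coeff_C_mul, coeff_X_mul, coeff_X_mul_zero,
      coeff_derivative, zero_add] at h
    push_cast at h ⊢
    linear_combination h
  · simp only [coeff_add, coeff_sub, coeff_neg, coeff_C_mul, coeff_X_mul,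
      coeff_derivative] at h
    push_cast at h ⊢
    linear_combination h

lemma natDegree_jacobiPoly_le (α β : ℝ) (n : ℕ) : (jacobiPoly α β n).natDegree ≤ n := by
  refine natDegree_comp_le.trans ?_
  have h1 : (C (1 / 2) * (X - 1) : ℝ[X]).natDegree ≤ 1 :=
    (natDegree_C_mul_le _ _).trans (natDegree_X_sub_C_le 1)
  calc _ ≤ n * 1 := Nat.mul_le_mul (natDegree_jacobiShift_le α β n) h1
    _ = n := mul_one n

/-- If the leading coefficient vanished, the recurrence, whose factor `(n-j)(n+j+2l)` is nonzero for
`j < n`, would annihilate every coefficient. -/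
lemma coeff_jacobiPoly_self_ne_zero {l : ℝ} (hl : 0 < l) (n : ℕ) :
    (jacobiPoly (l - 1 / 2) (l - 1 / 2) n).coeff n ≠ 0 := by
  intro h0
  refine jacobiPoly_ne_zero (by linarith : -1 < l - 1 / 2) (l - 1 / 2) n (Polynomial.ext fun j => ?_)
  rw [coeff_zero]
  refine down_two_induction (n := n)
    (p := fun j => (jacobiPoly (l - 1 / 2) (l - 1 / 2) n).coeff j = 0)
    (fun j hj => ?_) (fun j hj h2 => ?_) j
  · rcases hj.eq_or_lt with rfl | hj
    · exact h0
    · exact coeff_eq_zero_of_natDegree_lt ((natDegree_jacobiPoly_le _ _ n).trans_lt hj)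
  · have h3 := coeff_jacobiPoly_succ_succ l n j
    rw [h2, mul_zero, zero_eq_neg] at h3
    refine (mul_eq_zero.mp h3).resolve_left (mul_ne_zero ?_ (by positivity))
    rw [sub_ne_zero]
    exact_mod_cast hj.ne'

lemma tendsto_sq_inv_sqrt_mul {l : ℕ → ℝ} (hl : Tendsto l atTop atTop) (b : ℝ) :
    Tendsto (fun i => (b + 2 * l i) / l i) atTop (𝓝 2) := by
  have h1 : Tendsto (fun i => b / l i + 2) atTop (𝓝 (0 + 2)) := (hl.const_div_atTop b).add_const 2
  rw [zero_add] at h1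
  refine h1.congr' ?_
  filter_upwards [hl.eventually_gt_atTop 0] with i hi
  field_simp

/-- The rescaled ultraspherical polynomials converge to the Hermite polynomials. -/
lemma tendsto_coeff_jacobiPoly_hermitePoly {l : ℕ → ℝ} (hl0 : ∀ i, 0 < l i)
    (hl : Tendsto l atTop atTop) {κ : ℕ → ℝ} (n : ℕ)
    (hκ : ∀ i, κ i * (jacobiPoly (l i - 1 / 2) (l i - 1 / 2) n).coeff n * (1 / √(l i)) ^ n = 2 ^ n)
    (j : ℕ) :
    Tendsto (fun i => κ i * (jacobiPoly (l i - 1 / 2) (l i - 1 / 2) n).coeff j * (1 / √(l i)) ^ j)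
      atTop (𝓝 ((hermitePoly n).coeff j)) := by
  refine down_two_induction (n := n) (p := fun j => Tendsto (fun i => κ i *
      (jacobiPoly (l i - 1 / 2) (l i - 1 / 2) n).coeff j * (1 / √(l i)) ^ j) atTop
      (𝓝 ((hermitePoly n).coeff j))) (fun j hj => ?_) (fun j hj h2 => ?_) j
  · rcases hj.eq_or_lt with rfl | hj
    · simp_rw [hκ, coeff_hermitePoly_self]; exact tendsto_const_nhds
    · rw [coeff_hermitePoly_of_lt hj]
      simp_rw [fun i => coeff_eq_zero_of_natDegree_lt
        ((natDegree_jacobiPoly_le (l i - 1 / 2) (l i - 1 / 2) n).trans_lt hj)]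
      simp
  · have hnj : (n - j : ℝ) ≠ 0 := by rw [sub_ne_zero]; exact_mod_cast hj.ne'
    -- After rescaling, the recurrence solved for the coefficient `j` contains `(n+j+2l)/l`, which
    -- tends to `2`; in the limit it is the Hermite recurrence.
    have h3 := (((h2.const_mul ((j + 2 : ℝ) * (j + 1))).div
      (tendsto_sq_inv_sqrt_mul hl (n + j)) two_ne_zero).div_const (n - j : ℝ)).neg
    have h4 : -((j + 2 : ℝ) * (j + 1) * (hermitePoly n).coeff (j + 2) / 2 / (n - j))
        = (hermitePoly n).coeff j := by
      rw [coeff_hermitePoly_succ_succ]; field_simp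
    rw [h4] at h3
    refine h3.congr fun i => ?_
    have h5 := coeff_jacobiPoly_succ_succ (l i) n j
    have h6 := hl0 i
    have h7 : (n + j + 2 * l i : ℝ) ≠ 0 := by positivity
    have h8 : (1 / √(l i)) ^ 2 = 1 / l i := by rw [div_pow, one_pow, Real.sq_sqrt h6.le]
    simp only [Pi.div_apply]
    rw [pow_add, h8]
    have h9 : l i ≠ 0 := h6.ne'
    generalize (1 / √(l i)) ^ j = s
    generalize (jacobiPoly (l i - 1 / 2) (l i - 1 / 2) n).coeff j = x at h5 ⊢
    generalize (jacobiPoly (l i - 1 / 2) (l i - 1 / 2) n).coeff (j + 2) = y at h5 ⊢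
    field_simp
    linear_combination (-(κ i) * s) * h5

/-- The image of the ultraspherical weight under the rescaling by `√l`, up to a constant. -/
noncomputable def ultrasphericalWeight (l : ℝ) (y : ℝ) : ℝ :=
  (Set.Ioo (-1 : ℝ) 1).indicator (fun x => (1 - x) ^ (l - 1 / 2) * (1 + x) ^ (l - 1 / 2))
    (0 + 1 / √l * y)

lemma measurable_ultrasphericalWeight (l : ℝ) : Measurable (ultrasphericalWeight l) :=
  (Measurable.indicator (by fun_prop) measurableSet_Ioo).comp
    (by fun_prop : Measurable fun y : ℝ => 0 + 1 / √l * y)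

lemma hasWeight_ultraspherical {l : ℝ} (hl : 1 ≤ l) :
    HasWeight (jacobiMeasure (l - 1 / 2) (l - 1 / 2)) (fun y => 0 + 1 / √l * y)
      (ultrasphericalWeight l) := by
  have h0 : 0 < √l := Real.sqrt_pos.mpr (by linarith)
  rw [jacobiMeasure_eq]
  refine hasWeight_withDensity (measurable_jacobiDensity _ _) 0 (by positivity)
    (jacobiConst_pos (α := l - 1 / 2) (β := l - 1 / 2) (by linarith) (by linarith)) fun y => ?_
  rw [jacobiDensity, ultrasphericalWeight, Set.indicator_const_mul]

lemma ultrasphericalWeight_eq {l : ℝ} (hl : 1 ≤ l) (y : ℝ) :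
    ultrasphericalWeight l y = if y ^ 2 < l then (1 - y ^ 2 / l) ^ (l - 1 / 2) else 0 := by
  have hl0 : 0 < l := by linarith
  have h1 : (1 / √l * y) ^ 2 = y ^ 2 / l := by
    rw [mul_pow, div_pow, one_pow, Real.sq_sqrt hl0.le]; ring
  rw [ultrasphericalWeight, zero_add]
  have h2 : 1 / √l * y ∈ Set.Ioo (-1 : ℝ) 1 ↔ y ^ 2 < l := by
    rw [Set.mem_Ioo, ← abs_lt, ← sq_lt_one_iff_abs_lt_one, h1, div_lt_one hl0]
  by_cases h : y ^ 2 < l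
  · have h3 := h2.mpr h
    rw [Set.indicator_of_mem h3, if_pos h,
      ← Real.mul_rpow (by linarith [h3.2]) (by linarith [h3.1]), ← h1]
    congr 1; ring
  · rw [Set.indicator_of_notMem (fun h3 => h (h2.mp h3)), if_neg h]

/-- From `1 - u ≤ e^(-u)` the exponent is `-(y²/l)(l - 1/2)`, and `l ≥ 1` makes this at most
`-y²/2`, a majorant independent of `l`. -/
lemma ultrasphericalWeight_le {l : ℝ} (hl : 1 ≤ l) (y : ℝ) :
    ultrasphericalWeight l y ≤ Real.exp (-(1 / 2) * y ^ 2) := by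
  have hl0 : 0 < l := by linarith
  rw [ultrasphericalWeight_eq hl]
  split_ifs with h
  · have h1 : y ^ 2 / l < 1 := (div_lt_one hl0).mpr h
    have h2 : 1 - y ^ 2 / l ≤ Real.exp (-(y ^ 2 / l)) := by
      linarith [Real.add_one_le_exp (-(y ^ 2 / l))]
    refine (Real.rpow_le_rpow (by linarith) h2 (by linarith)).trans ?_
    rw [← Real.exp_mul]
    refine Real.exp_le_exp.mpr ?_
    have h3 : 0 ≤ y ^ 2 / l := by positivity
    have h4 : y ^ 2 / l * l = y ^ 2 := by field_simp
    nlinarith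
  · exact (Real.exp_pos _).le

lemma tendsto_ultrasphericalWeight (y : ℝ) :
    Tendsto (fun l => ultrasphericalWeight l y) atTop (𝓝 (Real.exp (-1 * y ^ 2))) := by
  have h1 := Real.tendsto_one_add_div_rpow_exp (-1 * y ^ 2)
  have h2 : Tendsto (fun l : ℝ => (1 + (-1 * y ^ 2) / l) ^ (-(1 / 2) : ℝ)) atTop (𝓝 1) := by
    have h3 : Tendsto (fun l : ℝ => 1 + (-1 * y ^ 2) / l) atTop (𝓝 (1 + 0)) :=
      tendsto_const_nhds.add (tendsto_id.const_div_atTop _)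
    rw [add_zero] at h3
    simpa using h3.rpow_const (p := -(1 / 2)) (Or.inl one_ne_zero)
  have h4 := h1.mul h2
  rw [mul_one] at h4
  refine h4.congr' ?_
  filter_upwards [eventually_ge_atTop 1, eventually_gt_atTop (y ^ 2)] with l hl hy
  have hl0 : 0 < l := by linarith
  have h5 : y ^ 2 / l < 1 := (div_lt_one hl0).mpr hy
  rw [ultrasphericalWeight_eq hl, if_pos hy, ← Real.rpow_add (by
    rw [mul_div_assoc]; linarith)]
  congr 1
  ring

/-- The eigenvalue is `(k+1)(k+1+2l)`, so division by `l` leaves `2(k+1)` in the limit, the Hermite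
eigenvalue. -/
lemma tendsto_ultraspherical_factor (k : ℕ) (y : ℝ) :
    Tendsto (fun l : ℝ => √((1 - X ^ 2 : ℝ[X]).eval (0 + 1 / √l * y))
        / (1 / √l * √(jacobiEv (l - 1 / 2) (l - 1 / 2) (k + 1)))) atTop
      (𝓝 (1 * (√((1 : ℝ[X]).eval y) / √(hermiteEv (k + 1))))) := by
  have hk : (0 : ℝ) < k + 1 := by positivity
  have h1 : Tendsto (fun l : ℝ => (1 - y ^ 2 / l) / (((k + 1) / l + 2) * (k + 1))) atTop
      (𝓝 ((1 - 0) / ((0 + 2) * ((k : ℝ) + 1)))) :=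
    (tendsto_const_nhds.sub (tendsto_id.const_div_atTop _)).div
      (((tendsto_id.const_div_atTop _).add_const 2).mul_const _) (by positivity)
  have h2 := h1.sqrt
  have h3 : 1 * (√((1 : ℝ[X]).eval y) / √(hermiteEv (k + 1)))
      = √((1 - 0) / ((0 + 2) * ((k : ℝ) + 1))) := by
    rw [Real.sqrt_div' _ (by positivity), hermiteEv]
    simp
  rw [h3]
  refine h2.congr' ?_
  filter_upwards [eventually_gt_atTop 0] with l hl
  have hs := Real.sqrt_pos.mpr hl
  have h4 : (1 / √l * y) ^ 2 = y ^ 2 / l := by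
    rw [mul_pow, div_pow, one_pow, Real.sq_sqrt hl.le]; ring
  have h5 : 1 / √l = √(1 / l) := by rw [Real.sqrt_div' _ hl.le, Real.sqrt_one]
  rw [zero_add, eval_sub, eval_one, eval_pow, eval_X, h4, h5, ← Real.sqrt_mul (by positivity),
    ← Real.sqrt_div']
  · congr 2
    rw [jacobiEv]
    push_cast
    field_simp
    ring
  · rw [jacobiEv]
    push_cast
    have : (0 : ℝ) < k + 1 + (l - 1 / 2) + (l - 1 / 2) + 1 := by
      have : (0 : ℝ) ≤ k := k.cast_nonneg
      linarith
    positivity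

/-- Boundedness of the ultraspherical Riesz transforms gives that of the Gaussian one. -/
theorem boundedOnLp_gaussianRiesz {p : ℝ≥0∞} (hp : 1 ≤ p) (hp' : p ≠ ∞) {C₀ : ℝ}
    (h : ∃ᶠ l : ℝ in atTop, BoundedOnLp (jacobiMeasure (l - 1 / 2) (l - 1 / 2))
      (IsJacobiRiesz (l - 1 / 2) (l - 1 / 2)) p C₀) :
    BoundedOnLp hermiteMeasure IsGaussianRiesz p C₀ := by
  have hp0 : p ≠ 0 := (zero_lt_one.trans_le hp).ne'
  obtain ⟨l, hl, hlB⟩ := exists_seq_forall_of_frequently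
    (h.and_eventually (eventually_ge_atTop 1))
  have hR : ∀ i, IsJacobiRiesz (l i - 1 / 2) (l i - 1 / 2) =
      IsRiesz (jacobiMeasure (l i - 1 / 2) (l i - 1 / 2)) (1 - X ^ 2)
        (jacobiEv (l i - 1 / 2) (l i - 1 / 2)) (jacobiPoly (l i - 1 / 2) (l i - 1 / 2)) :=
    fun i => by ext f g; exact isJacobiRiesz_iff _ _ f g
  have hG : IsGaussianRiesz = IsRiesz hermiteMeasure 1 hermiteEv hermitePoly := by
    ext f g; exact isGaussianRiesz_iff f g
  have hC : 0 ≤ C₀ := by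
    have := isFiniteMeasure_jacobiMeasure (α := l 0 - 1 / 2) (β := l 0 - 1 / 2)
      (by linarith [(hlB 0).2]) (by linarith [(hlB 0).2])
    have := jacobiMeasure_ne_zero (α := l 0 - 1 / 2) (β := l 0 - 1 / 2)
      (by linarith [(hlB 0).2]) (by linarith [(hlB 0).2])
    exact RieszSystem.nonneg_of_boundedOnLp hp (hlB 0).1
  have hl0 : ∀ i, 0 < l i := fun i => by linarith [(hlB i).2]
  have hs : ∀ i, 1 / √(l i) ≠ 0 := fun i => by
    have := Real.sqrt_pos.mpr (hl0 i); positivity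
  rw [hG]
  refine rieszSystem_hermite.boundedOnLp degree_hermitePoly
    (fun r hr hr' => polynomialDense_hermiteMeasure hr hr') hp hp' hC ?_
  -- This choice gives the rescaled polynomial the leading coefficient `2^k` of `H_k` exactly, which
  -- anchors the descending recurrence.
  let κ : ℕ → ℕ → ℝ := fun i k => 2 ^ k /
    ((jacobiPoly (l i - 1 / 2) (l i - 1 / 2) k).coeff k * (1 / √(l i)) ^ k)
  refine eLpNorm_rieszComb_le_of_tendsto hp0 hp'
    (P := fun i => jacobiPoly (l i - 1 / 2) (l i - 1 / 2)) hs
    (fun i => hasWeight_ultraspherical (hlB i).2) hasWeight_hermiteMeasure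
    (fun i => measurable_ultrasphericalWeight (l i))
    (fun y => (tendsto_ultrasphericalWeight y).comp hl)
    (fun i => ultrasphericalWeight_le (hlB i).2)
    (fun q => lintegral_eval_rpow_ne_top q (ENNReal.toReal_pos hp0 hp')
      (by norm_num : (0 : ℝ) < 1 / 2 / 2) (lintegral_exp_mul_gaussian_ne_top (by norm_num)))
    κ (fun i k => rfl) (fun i k => ?_) natDegree_hermitePoly_le (fun k j => ?_)
    (abs_one) (fun k y => (tendsto_ultraspherical_factor k y).comp hl) (fun i c => ?_)
  · refine (natDegree_C_mul_le _ _).trans (natDegree_comp_le.trans ?_)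
    calc _ ≤ k * 1 := Nat.mul_le_mul (natDegree_jacobiPoly_le _ _ k) (by
          rw [C_0, zero_add]; exact (natDegree_C_mul_le _ _).trans natDegree_X_le)
      _ = k := mul_one k
  · simp only [C_0, zero_add, coeff_C_mul, comp_C_mul_X_coeff, ← mul_assoc]
    refine tendsto_coeff_jacobiPoly_hermitePoly hl0 hl k (fun i => ?_) j
    have h1 := coeff_jacobiPoly_self_ne_zero (hl0 i) k
    have h2 := pow_ne_zero k (hs i)
    rw [mul_assoc, div_mul_cancel₀ _ (mul_ne_zero h1 h2)]
  · have h1 := (hlB i).1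
    rw [hR] at h1
    exact (rieszSystem_jacobi (by linarith [(hlB i).2]) (by linarith [(hlB i).2])).eLpNorm_rieszComb_le
      hp' h1 c

/-! ### Laguerre polynomials and the Gamma measure -/

/-- The coefficients of the Laguerre polynomial. -/
noncomputable def laguerreCoeff (α : ℝ) (n j : ℕ) : ℝ :=
  (n.choose j : ℝ) / (n.factorial : ℝ) * (ascPochhammer ℝ (n - j)).eval (α + j + 1) * (-1) ^ j

/-- The Laguerre polynomial. -/
noncomputable def laguerrePoly (α : ℝ) (n : ℕ) : ℝ[X] :=
  ∑ j ∈ Finset.range (n + 1), monomial j (laguerreCoeff α n j)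

/-- The form of `laguerreCoeff` with a binomial coefficient mirrors `jacobiCoeff`, so that the later
limit concerns a single Pochhammer factor. -/
lemma laguerrePoly_eval (α : ℝ) (n : ℕ) (x : ℝ) : (laguerrePoly α n).eval x = laguerreL α n x := by
  simp only [laguerrePoly, laguerreL, laguerreCoeff, eval_finsetSum, eval_monomial]
  refine Finset.sum_congr rfl fun j hj => ?_
  have hj' : j ≤ n := Nat.lt_succ_iff.mp (Finset.mem_range.mp hj)
  have h1 := congrArg (Nat.cast (R := ℝ)) (Nat.choose_mul_factorial_mul_factorial hj')
  push_cast at h1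
  have h2 : (n.factorial : ℝ) ≠ 0 := by positivity
  have h3 : (j.factorial : ℝ) ≠ 0 := by positivity
  have h4 : ((n - j).factorial : ℝ) ≠ 0 := by positivity
  have h5 : (n.choose j : ℝ) / (n.factorial : ℝ)
      = 1 / ((j.factorial : ℝ) * ((n - j).factorial : ℝ)) := by
    rw [div_eq_div_iff h2 (mul_ne_zero h3 h4)]; linarith
  rw [h5, neg_pow x j]
  field_simp

lemma coeff_laguerrePoly (α : ℝ) (n j : ℕ) : (laguerrePoly α n).coeff j = laguerreCoeff α n j := by
  simp only [laguerrePoly, finsetSum_coeff, coeff_monomial, Finset.sum_ite_eq', Finset.mem_range]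
  split_ifs with h
  · rfl
  · simp [laguerreCoeff, Nat.choose_eq_zero_of_lt (by omega : n < j)]

lemma natDegree_laguerrePoly_le (α : ℝ) (n : ℕ) : (laguerrePoly α n).natDegree ≤ n :=
  natDegree_sum_le_of_forall_le _ _ fun _ hj =>
    (natDegree_monomial_le _).trans (Nat.lt_succ_iff.mp (Finset.mem_range.mp hj))

lemma degree_laguerrePoly (α : ℝ) (n : ℕ) : (laguerrePoly α n).degree = n := by
  refine degree_eq_of_le_of_coeff_ne_zero
    (natDegree_le_iff_degree_le.mp (natDegree_laguerrePoly_le α n)) ?_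
  have h : (n.factorial : ℝ) ≠ 0 := by positivity
  simp [coeff_laguerrePoly, laguerreCoeff, h]

lemma laguerreCoeff_succ (α : ℝ) (n j : ℕ) :
    laguerreCoeff α n (j + 1) * ((j + 1) * (j + α + 1)) = -(laguerreCoeff α n j * (n - j)) := by
  rcases lt_trichotomy j n with h | rfl | h
  · have h1 : ((n.choose (j + 1) : ℕ) : ℝ) * (j + 1) = n.choose j * (n - j) := by
      have := congrArg (Nat.cast (R := ℝ)) (Nat.choose_succ_right_eq n j)
      push_cast [Nat.cast_sub h.le] at this
      exact this
    have h2 : (ascPochhammer ℝ (n - j)).eval (α + j + 1)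
        = (α + j + 1) * (ascPochhammer ℝ (n - (j + 1))).eval (α + (j + 1 : ℕ) + 1) := by
      rw [show n - j = (n - (j + 1)) + 1 by omega, ascPochhammer_eval_succ_left]
      push_cast; ring_nf
    unfold laguerreCoeff
    rw [h2, pow_succ]
    linear_combination (-(1 / (n.factorial : ℝ) *
      (ascPochhammer ℝ (n - (j + 1))).eval (α + (j + 1 : ℕ) + 1) * (-1) ^ j * (j + α + 1))) * h1
  · simp [laguerreCoeff]
  · simp [laguerreCoeff, Nat.choose_eq_zero_of_lt h,
      Nat.choose_eq_zero_of_lt (h.trans j.lt_succ_self)]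

/-- The eigenvalues of the Laguerre operator. -/
noncomputable def laguerreEv (k : ℕ) : ℝ := k

lemma laguerrePoly_ode (α : ℝ) (n : ℕ) :
    X * derivative (derivative (laguerrePoly α n)) + (C (α + 1) - X) * derivative (laguerrePoly α n)
      = -(C (laguerreEv n) * laguerrePoly α n) := by
  ext j
  have h := laguerreCoeff_succ α n
  rw [sub_mul]
  rcases j with - | j
  · have := h 0
    simp only [coeff_add, coeff_sub, coeff_neg, coeff_C_mul, coeff_X_mul_zero, coeff_derivative,
      coeff_laguerrePoly, laguerreEv]
    push_cast at this ⊢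
    linear_combination this
  · have := h (j + 1)
    simp only [coeff_add, coeff_sub, coeff_neg, coeff_C_mul, coeff_X_mul, coeff_derivative,
      coeff_laguerrePoly, laguerreEv]
    push_cast at this ⊢
    linear_combination this

/-- The minus sign here is the one in front of the Laguerre-Riesz series. -/
lemma derivative_laguerrePoly_succ (α : ℝ) (n : ℕ) :
    derivative (laguerrePoly α (n + 1)) = -laguerrePoly (α + 1) n := by
  ext j
  rw [coeff_derivative, coeff_neg, coeff_laguerrePoly, coeff_laguerrePoly]
  have h2 : ((n + 1).choose (j + 1) : ℝ) * (j + 1) = (n + 1) * n.choose j := by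
    have := Nat.add_one_mul_choose_eq n j
    exact_mod_cast this.symm
  have h3 : (((n + 1).factorial : ℕ) : ℝ) = (n + 1) * n.factorial := by
    rw [Nat.factorial_succ]; push_cast; ring
  have h4 : (n.factorial : ℝ) ≠ 0 := by positivity
  have h5 : (n + 1 : ℝ) ≠ 0 := by positivity
  unfold laguerreCoeff
  rw [Nat.add_sub_add_right, h3, pow_succ]
  push_cast
  rw [show α + (j + 1) + 1 = α + 1 + j + 1 by ring]
  field_simp
  linear_combination (-(ascPochhammer ℝ (n - j)).eval (α + 1 + j + 1)) * h2

lemma isLaguerreRiesz_iff (α : ℝ) (f g : ℝ → ℝ) :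
    IsLaguerreRiesz α f g ↔ IsRiesz (laguerreMeasure α) X laguerreEv (laguerrePoly α) f g := by
  unfold IsLaguerreRiesz IsRiesz
  refine iff_of_eq ?_
  congr 1
  ext n x
  simp only [rieszFun, derivative_laguerrePoly_succ, eval_neg, laguerrePoly_eval, laguerreEv,
    eval_X]
  push_cast
  ring

/-- The weight `y^α e^{-by}` on `(0, ∞)`. -/
noncomputable def gammaWeight (α b : ℝ) : ℝ → ℝ :=
  (Set.Ioi (0 : ℝ)).indicator fun y => y ^ α * Real.exp (-b * y)

lemma measurable_gammaWeight (α b : ℝ) : Measurable (gammaWeight α b) :=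
  Measurable.indicator (by fun_prop) measurableSet_Ioi

lemma gammaWeight_nonneg (α b y : ℝ) : 0 ≤ gammaWeight α b y :=
  Set.indicator_nonneg (fun _ hy => mul_nonneg (Real.rpow_nonneg (le_of_lt hy) _)
    (Real.exp_pos _).le) y

lemma integrable_gammaWeight {α b : ℝ} (hα : -1 < α) (hb : 0 < b) :
    Integrable (gammaWeight α b) := by
  rw [gammaWeight, integrable_indicator_iff measurableSet_Ioi]
  simpa using integrableOn_rpow_mul_exp_neg_mul_rpow hα one_pos hb

lemma exp_mul_gammaWeight (α b t y : ℝ) :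
    Real.exp (t * y) * gammaWeight α b y = gammaWeight α (b - t) y := by
  by_cases hy : y ∈ Set.Ioi (0 : ℝ)
  · rw [gammaWeight, gammaWeight, Set.indicator_of_mem hy, Set.indicator_of_mem hy,
      mul_left_comm, ← Real.exp_add]
    congr 2; ring
  · rw [gammaWeight, gammaWeight, Set.indicator_of_notMem hy, Set.indicator_of_notMem hy, mul_zero]

lemma exp_abs_mul_gammaWeight (α b t y : ℝ) :
    Real.exp (t * |y|) * gammaWeight α b y = gammaWeight α (b - t) y := by
  rw [← exp_mul_gammaWeight]
  by_cases hy : y ∈ Set.Ioi (0 : ℝ)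
  · rw [abs_of_pos hy]
  · rw [gammaWeight, Set.indicator_of_notMem hy, mul_zero, mul_zero]

lemma lintegral_exp_mul_gammaWeight_ne_top {α b : ℝ} (hα : -1 < α) (hb : 0 < b) :
    ∫⁻ y, ENNReal.ofReal (Real.exp (b / 2 * |y|) * gammaWeight α b y) ≠ ∞ := by
  simp_rw [exp_abs_mul_gammaWeight]
  exact (integrable_gammaWeight hα (by linarith : 0 < b - b / 2)).lintegral_lt_top.ne

lemma laguerreMeasure_eq (α : ℝ) : laguerreMeasure α
    = volume.withDensity fun x => ENNReal.ofReal ((Real.Gamma (α + 1))⁻¹ * gammaWeight α 1 x) := by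
  rw [laguerreMeasure, gammaMeasure]
  refine withDensity_congr_ae ?_
  -- The Gamma density is supported on `x ≥ 0` and `gammaWeight` on `x > 0`; they can differ only at
  -- the origin.
  filter_upwards [Measure.ae_ne volume (0 : ℝ)] with x hx
  rw [gammaPDF, gammaPDFReal]
  congr 1
  rcases lt_or_gt_of_ne hx with h | h
  · rw [if_neg (not_le.mpr h), gammaWeight, Set.indicator_of_notMem (by simpa using h.le), mul_zero]
  · rw [if_pos h.le, gammaWeight, Set.indicator_of_mem (by simpa using h)]
    simp only [Real.one_rpow, add_sub_cancel_right, one_mul, neg_mul, one_div]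
    ring

lemma Gamma_inv_pos {α : ℝ} (hα : -1 < α) : 0 < (Real.Gamma (α + 1))⁻¹ :=
  inv_pos.mpr (Real.Gamma_pos_of_pos (by linarith))

lemma hasWeight_laguerreMeasure {α : ℝ} (hα : -1 < α) :
    HasWeight (laguerreMeasure α) (fun y => y) (gammaWeight α 1) := by
  have h1 := hasWeight_withDensity ((measurable_gammaWeight α 1).const_mul (Real.Gamma (α + 1))⁻¹)
    0 one_ne_zero (W := gammaWeight α 1) (Gamma_inv_pos hα)
    (fun y => by rw [zero_add, one_mul])
  rw [laguerreMeasure_eq]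
  simpa only [zero_add, one_mul] using h1

lemma memLp_mul_exp_laguerreMeasure {α : ℝ} (hα : -1 < α) (q : ℝ[X]) {r : ℝ≥0∞} (hr : r ≠ 0)
    (hr' : r ≠ ∞) {t : ℝ} (ht : t * r.toReal < 1) :
    MemLp (fun x => q.eval x * Real.exp (t * x)) r (laguerreMeasure α) := by
  have hr0 := ENNReal.toReal_pos hr hr'
  refine (hasWeight_laguerreMeasure hα).memLp hr hr' (by fun_prop) ?_
  have h1 := lintegral_eval_rpow_ne_top q hr0 (half_pos (sub_pos.mpr ht))
    (lintegral_exp_mul_gammaWeight_ne_top hα (sub_pos.mpr ht))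
  convert h1 using 3 with y
  rw [enorm_mul, ENNReal.mul_rpow_of_nonneg _ _ hr0.le, mul_assoc]
  congr 1
  rw [← ofReal_norm, Real.norm_eq_abs, Real.abs_exp,
    ENNReal.ofReal_rpow_of_nonneg (Real.exp_pos _).le hr0.le,
    ← ENNReal.ofReal_mul (by positivity), ← Real.exp_mul, ← exp_mul_gammaWeight]
  congr 3
  ring

lemma memLp_eval_laguerreMeasure {α : ℝ} (hα : -1 < α) (q : ℝ[X]) (r : ℝ≥0∞) (hr' : r ≠ ∞) :
    MemLp (fun x => q.eval x) r (laguerreMeasure α) := by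
  rcases eq_or_ne r 0 with rfl | hr
  · exact memLp_zero_iff_aestronglyMeasurable.mpr q.continuous.aestronglyMeasurable
  · simpa using memLp_mul_exp_laguerreMeasure hα q hr hr' (t := 0) (by simp)

lemma isProbabilityMeasure_laguerreMeasure {α : ℝ} (hα : -1 < α) :
    IsProbabilityMeasure (laguerreMeasure α) :=
  isProbabilityMeasure_gammaMeasure (by linarith) one_pos

lemma ae_pos_laguerreMeasure (α : ℝ) : ∀ᵐ x ∂laguerreMeasure α, 0 < x := by
  rw [laguerreMeasure_eq, ae_withDensity_iff
    ((measurable_gammaWeight α 1).const_mul _).ennreal_ofReal]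
  refine ae_of_all _ fun x hx => ?_
  by_contra h
  refine hx ?_
  rw [gammaWeight, Set.indicator_of_notMem (Set.notMem_Ioi.mpr (not_lt.mp h)), mul_zero,
    ENNReal.ofReal_zero]

lemma polynomialDense_laguerreMeasure {α : ℝ} (hα : -1 < α) {r : ℝ≥0∞} (hr : 1 ≤ r)
    (hr' : r ≠ ∞) : PolynomialDense (laguerreMeasure α) r := by
  have := isProbabilityMeasure_laguerreMeasure hα
  have hr0 := (zero_lt_one.trans_le hr).ne'
  have h0 := ENNReal.toReal_pos hr0 hr'
  have h1 : 2 * (1 / (4 * r.toReal)) * r.toReal < 1 := by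
    field_simp; norm_num
  refine polynomialDense_of_exp_moment hr hr' (fun q => memLp_eval_laguerreMeasure hα q r hr')
    ((ae_pos_laguerreMeasure α).mono fun x hx => hx.le)
    (t := 1 / (4 * r.toReal)) (by positivity) ?_
  simpa using memLp_mul_exp_laguerreMeasure hα 1 hr0 hr' h1

/-- The Pearson equation of the Gamma measure. -/
lemma integral_laguerreMeasure_pearson {α : ℝ} (hα : -1 < α) (q : ℝ[X]) :
    ∫ x, (X * derivative q + (C (α + 1) - X) * q).eval x ∂laguerreMeasure α = 0 := by
  set K := (Real.Gamma (α + 1))⁻¹ with hK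
  have hKpos := Gamma_inv_pos hα
  have hmeas := ((measurable_gammaWeight α 1).const_mul K).ennreal_ofReal
  have hnn : ∀ x, 0 ≤ K * gammaWeight α 1 x := fun x =>
    mul_nonneg hKpos.le (gammaWeight_nonneg _ _ _)
  have hind : ∀ q : ℝ[X], (fun x => K * gammaWeight α 1 x * q.eval x) =
      (Set.Ioi (0 : ℝ)).indicator fun x => K * (x ^ α * Real.exp (-1 * x)) * q.eval x := by
    intro q
    ext x
    by_cases hx : x ∈ Set.Ioi (0 : ℝ)
    · rw [gammaWeight, Set.indicator_of_mem hx, Set.indicator_of_mem hx]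
    · rw [gammaWeight, Set.indicator_of_notMem hx, Set.indicator_of_notMem hx, mul_zero, zero_mul]
  have hint : ∀ q : ℝ[X], IntegrableOn (fun x => K * (x ^ α * Real.exp (-1 * x)) * q.eval x)
      (Set.Ioi 0) := by
    intro q
    have h1 := memLp_one_iff_integrable.mp (memLp_eval_laguerreMeasure hα q 1 ENNReal.one_ne_top)
    rw [laguerreMeasure_eq, integrable_withDensity_iff_integrable_smul' hmeas
      (ae_of_all _ fun _ => ENNReal.ofReal_lt_top)] at h1
    simp only [ENNReal.toReal_ofReal (hnn _), smul_eq_mul] at h1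
    rwa [hind q, integrable_indicator_iff measurableSet_Ioi] at h1
  have hpow : ∀ x ∈ Set.Ioi (0 : ℝ), K * (x ^ α * Real.exp (-1 * x)) * (X * q).eval x
      = K * (x ^ (α + 1) * Real.exp (-1 * x) * q.eval x) := fun x hx => by
    rw [Real.rpow_add_one (ne_of_gt hx)]
    simp only [eval_mul, eval_X]
    ring
  have hderiv : ∀ x ∈ Set.Ioi (0 : ℝ), HasDerivAt
      (fun x => K * (x ^ (α + 1) * Real.exp (-1 * x) * q.eval x))
      (K * (x ^ α * Real.exp (-1 * x)) * (X * derivative q + (C (α + 1) - X) * q).eval x) x := by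
    intro x hx
    have h1 : HasDerivAt (fun y : ℝ => -1 * y) (-1) x := by
      simpa using (hasDerivAt_id x).const_mul (-1)
    refine ((((Real.hasDerivAt_rpow_const (p := α + 1) (Or.inl (ne_of_gt hx))).mul h1.exp).mul
      (q.hasDerivAt x)).const_mul K).congr_deriv ?_
    rw [Pi.mul_apply, add_sub_cancel_right, Real.rpow_add_one (ne_of_gt hx)]
    simp only [eval_add, eval_mul, eval_sub, eval_X, eval_C]
    ring
  -- An integrable function with integrable derivative tends to zero at infinity, which removes the
  -- boundary term there; at `0` the exponent `α + 1 > 0` does.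
  have hfint : IntegrableOn (fun x => K * (x ^ (α + 1) * Real.exp (-1 * x) * q.eval x))
      (Set.Ioi 0) := (hint (X * q)).congr_fun hpow measurableSet_Ioi
  have hcont : Continuous fun x => K * (x ^ (α + 1) * Real.exp (-1 * x) * q.eval x) := by
    refine continuous_const.mul ((Continuous.mul ?_ (by fun_prop)).mul q.continuous)
    exact continuous_id.rpow_const fun x => Or.inr (by linarith)
  rw [laguerreMeasure_eq, integral_withDensity_eq_integral_toReal_smul hmeas
    (ae_of_all _ fun _ => ENNReal.ofReal_lt_top)]
  simp only [ENNReal.toReal_ofReal (hnn _), smul_eq_mul]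
  rw [hind, integral_indicator measurableSet_Ioi,
    integral_Ioi_of_hasDerivAt_of_tendsto hcont.continuousWithinAt hderiv (hint _)
      (tendsto_zero_of_hasDerivAt_of_integrableOn_Ioi hderiv (hint _) hfint)]
  simp [Real.zero_rpow (by linarith : α + 1 ≠ 0)]

/-- The Laguerre polynomials form a Riesz system. -/
lemma rieszSystem_laguerre {α : ℝ} (hα : -1 < α) :
    RieszSystem (laguerreMeasure α) X laguerreEv (laguerrePoly α) := by
  have := isProbabilityMeasure_laguerreMeasure hα
  refine RieszSystem.of_eigenfunctions (b := C (α + 1) - X) ?_ (memLp_eval_laguerreMeasure hα)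
    ((ae_pos_laguerreMeasure α).mono fun x hx => by simpa using hx.le)
    (integral_laguerreMeasure_pearson hα) (laguerrePoly_ode α) ?_ ?_ ?_ fun n h => ?_
  · rw [laguerreMeasure_eq]; exact withDensity_absolutelyContinuous _ _
  · intro m n h
    simpa [laguerreEv] using h
  · intro n; unfold laguerreEv; positivity
  · rw [eq_C_of_natDegree_le_zero (natDegree_laguerrePoly_le α 0), derivative_C]
  · have := degree_laguerrePoly α n
    simp [h] at this

/-! ### The limit from Jacobi to Laguerre polynomials -/

/-- The image of the Jacobi weight under the rescaling by `β / 2` at the endpoint `1`, up to a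
constant. -/
noncomputable def endpointWeight (α β : ℝ) : ℝ → ℝ :=
  (Set.Ioo (0 : ℝ) β).indicator fun y => y ^ α * (1 - y / β) ^ β

lemma measurable_endpointWeight (α β : ℝ) : Measurable (endpointWeight α β) :=
  Measurable.indicator (by fun_prop) measurableSet_Ioo

/-- With `x = 1 - 2y/β` one has `1 - x = (2/β) y` and `1 + x = 2(1 - y/β)`; the powers `(2/β)^α 2^β`
join the constant. -/
lemma hasWeight_endpoint {α β : ℝ} (hα : -1 < α) (hβ : 0 < β) :
    HasWeight (jacobiMeasure α β) (fun y => 1 + -(2 / β) * y) (endpointWeight α β) := by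
  rw [jacobiMeasure_eq]
  have hc := jacobiConst_pos hα (by linarith : -1 < β)
  refine hasWeight_withDensity (measurable_jacobiDensity _ _) 1
    (neg_ne_zero.mpr (by positivity)) (K := _ * ((2 / β) ^ α * 2 ^ β))
    (mul_pos hc (by positivity)) fun y => ?_
  have h1 : 1 + -(2 / β) * y ∈ Set.Ioo (-1 : ℝ) 1 ↔ y ∈ Set.Ioo 0 β := by
    have e1 : 1 + -(2 / β) * y = 1 - 2 * (y / β) := by ring
    rw [e1, Set.mem_Ioo, Set.mem_Ioo]
    constructor
    · rintro ⟨h2, h3⟩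
      have h4 : 0 < y / β := by linarith
      have h5 : y / β < 1 := by linarith
      exact ⟨by simpa [hβ] using (div_pos_iff_of_pos_right hβ).mp h4, (div_lt_one hβ).mp h5⟩
    · rintro ⟨h2, h3⟩
      have h4 : 0 < y / β := div_pos h2 hβ
      have h5 : y / β < 1 := (div_lt_one hβ).mpr h3
      exact ⟨by linarith, by linarith⟩
  by_cases h : y ∈ Set.Ioo 0 β
  · have h5 : y / β < 1 := (div_lt_one hβ).mpr h.2
    rw [jacobiDensity, endpointWeight, Set.indicator_of_mem (h1.mpr h), Set.indicator_of_mem h]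
    have e1 : 1 - (1 + -(2 / β) * y) = 2 / β * y := by ring
    have e2 : 1 + (1 + -(2 / β) * y) = 2 * (1 - y / β) := by ring
    rw [e1, e2, Real.mul_rpow (by positivity) h.1.le, Real.mul_rpow zero_le_two (by linarith)]
    ring
  · rw [jacobiDensity, endpointWeight, Set.indicator_of_notMem (fun h2 => h (h1.mp h2)),
      Set.indicator_of_notMem h, mul_zero]

lemma endpointWeight_le (α : ℝ) {β : ℝ} (hβ : 0 < β) (y : ℝ) :
    endpointWeight α β y ≤ gammaWeight α 1 y := by
  by_cases h : y ∈ Set.Ioo 0 β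
  · have h1 : y / β < 1 := (div_lt_one hβ).mpr h.2
    have h2 : 1 - y / β ≤ Real.exp (-(y / β)) := by
      linarith [Real.add_one_le_exp (-(y / β))]
    rw [endpointWeight, gammaWeight, Set.indicator_of_mem h, Set.indicator_of_mem (Set.mem_Ioi.mpr h.1)]
    refine mul_le_mul_of_nonneg_left ?_ (Real.rpow_nonneg h.1.le _)
    refine (Real.rpow_le_rpow (by linarith) h2 hβ.le).trans (le_of_eq ?_)
    rw [← Real.exp_mul]
    congr 1
    field_simp
  · rw [endpointWeight, Set.indicator_of_notMem h]
    exact gammaWeight_nonneg _ _ _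

lemma tendsto_endpointWeight (α y : ℝ) :
    Tendsto (fun β => endpointWeight α β y) atTop (𝓝 (gammaWeight α 1 y)) := by
  rcases le_or_gt y 0 with hy | hy
  · have h1 : ∀ β, endpointWeight α β y = 0 := fun β => by
      rw [endpointWeight, Set.indicator_of_notMem fun h => not_lt.mpr hy h.1]
    rw [gammaWeight, Set.indicator_of_notMem (by simpa using hy)]
    simp_rw [h1]
    exact tendsto_const_nhds
  · rw [gammaWeight, Set.indicator_of_mem (by simpa using hy)]
    refine ((Real.tendsto_one_add_div_rpow_exp (-1 * y)).const_mul (y ^ α)).congr' ?_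
    filter_upwards [eventually_gt_atTop y] with β hβ
    rw [endpointWeight, Set.indicator_of_mem (Set.mem_Ioo.mpr ⟨hy, hβ⟩)]
    congr 2
    ring

/-- Here `1 - x² = (4y/β)(1 - y/β)`, and the squared denominator is `(4/β²)(k+1)(k+α+2+β)`, so the
squared ratio tends to `y/(k+1)`. The negative scale `-2/β` accounts for the sign. -/
lemma tendsto_endpoint_factor (α : ℝ) (k : ℕ) (y : ℝ) :
    Tendsto (fun β : ℝ => √((1 - X ^ 2 : ℝ[X]).eval (1 + -(2 / β) * y))
        / (-(2 / β) * √(jacobiEv α β (k + 1)))) atTop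
      (𝓝 (-1 * (√((X : ℝ[X]).eval y) / √(laguerreEv (k + 1))))) := by
  have hk : (0 : ℝ) < k + 1 := by positivity
  have h1 : Tendsto (fun β : ℝ => (y * (1 - y / β)) / ((k + 1) * ((k + α + 2) / β + 1))) atTop
      (𝓝 ((y * (1 - 0)) / (((k : ℝ) + 1) * (0 + 1)))) :=
    ((tendsto_const_nhds.sub (tendsto_id.const_div_atTop _)).const_mul y).div
      (((tendsto_id.const_div_atTop _).add_const 1).const_mul _) (by positivity)
  have h2 := h1.sqrt.const_mul (-1)
  have h3 : √((X : ℝ[X]).eval y) / √(laguerreEv (k + 1))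
      = √((y * (1 - 0)) / (((k : ℝ) + 1) * (0 + 1))) := by
    rw [Real.sqrt_div' _ (by positivity), laguerreEv]
    simp
  rw [h3]
  refine h2.congr' ?_
  filter_upwards [eventually_gt_atTop 0, eventually_gt_atTop (-(k + α + 2))] with β hβ hβ'
  have h4 : √((2 / β) ^ 2) = 2 / β := Real.sqrt_sq (by positivity)
  have h5 : 0 < k + α + 2 + β := by linarith
  have h6 : jacobiEv α β (k + 1) = (k + 1) * (k + α + 2 + β) := by
    rw [jacobiEv]; push_cast; ring
  rw [h6, neg_mul (2 / β) (√_), div_neg, neg_one_mul]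
  congr 1
  nth_rewrite 2 [← h4]
  rw [← Real.sqrt_mul (by positivity), ← Real.sqrt_div' _ (by positivity)]
  congr 1
  simp only [eval_sub, eval_one, eval_pow, eval_X]
  field_simp
  ring

/-- Each of the `j` factors `b + i + β` is asymptotic to `β`. -/
lemma tendsto_ascPochhammer_div_pow (b : ℝ) (j : ℕ) :
    Tendsto (fun β : ℝ => (ascPochhammer ℝ j).eval (b + β) / β ^ j) atTop (𝓝 1) := by
  induction j with
  | zero => simp
  | succ j ih =>
    have h1 : Tendsto (fun β : ℝ => (b + j) / β + 1) atTop (𝓝 (0 + 1)) :=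
      (tendsto_id.const_div_atTop _).add_const 1
    have h2 := ih.mul h1
    rw [zero_add, mul_one] at h2
    refine h2.congr' ?_
    filter_upwards [eventually_gt_atTop 0] with β hβ
    rw [ascPochhammer_succ_eval, pow_succ]
    field_simp
    ring

/-- The Jacobi polynomials rescaled at the endpoint `1` converge to the Laguerre polynomials. -/
lemma tendsto_jacobiCoeff_laguerreCoeff (α : ℝ) (n j : ℕ) :
    Tendsto (fun β : ℝ => jacobiCoeff α β n j * (-(1 / β)) ^ j) atTop
      (𝓝 (laguerreCoeff α n j)) := by
  have h1 := ((tendsto_ascPochhammer_div_pow (n + α + 1) j).const_mul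
    ((n.choose j : ℝ) / (n.factorial : ℝ) * (ascPochhammer ℝ (n - j)).eval (α + j + 1)
      * (-1) ^ j))
  rw [mul_one] at h1
  refine h1.congr fun β => ?_
  rw [jacobiCoeff, neg_pow (1 / β), div_pow, one_pow, show (n + α + 1 + β : ℝ) = n + α + β + 1 by ring]
  ring

/-- Boundedness of the Jacobi-Riesz transforms for large `β` gives that of the Laguerre one. -/
theorem boundedOnLp_laguerreRiesz {p : ℝ≥0∞} (hp : 1 ≤ p) (hp' : p ≠ ∞) {C₀ α : ℝ}
    (hα : -1 < α)
    (h : ∃ᶠ β : ℝ in atTop, BoundedOnLp (jacobiMeasure α β) (IsJacobiRiesz α β) p C₀) :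
    BoundedOnLp (laguerreMeasure α) (IsLaguerreRiesz α) p C₀ := by
  have hp0 : p ≠ 0 := (zero_lt_one.trans_le hp).ne'
  obtain ⟨b, hb, hbB⟩ := exists_seq_forall_of_frequently
    (h.and_eventually (eventually_gt_atTop 0))
  have hR : ∀ i, IsJacobiRiesz α (b i) =
      IsRiesz (jacobiMeasure α (b i)) (1 - X ^ 2) (jacobiEv α (b i)) (jacobiPoly α (b i)) :=
    fun i => by ext f g; exact isJacobiRiesz_iff _ _ f g
  have hG : IsLaguerreRiesz α = IsRiesz (laguerreMeasure α) X laguerreEv (laguerrePoly α) := by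
    ext f g; exact isLaguerreRiesz_iff α f g
  have hC : 0 ≤ C₀ := by
    have := isFiniteMeasure_jacobiMeasure hα (hbB 0).2.le
    have := jacobiMeasure_ne_zero hα (by linarith [(hbB 0).2] : -1 < b 0)
    exact RieszSystem.nonneg_of_boundedOnLp hp (hbB 0).1
  have := isProbabilityMeasure_laguerreMeasure hα
  rw [hG]
  refine (rieszSystem_laguerre hα).boundedOnLp (degree_laguerrePoly α)
    (fun r hr hr' => polynomialDense_laguerreMeasure hα hr hr') hp hp' hC ?_
  refine eLpNorm_rieszComb_le_of_tendsto hp0 hp' (P := fun i => jacobiPoly α (b i))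
    (s := fun i => -(2 / b i)) (fun i => by have := (hbB i).2; exact neg_ne_zero.mpr (by positivity))
    (fun i => hasWeight_endpoint hα (hbB i).2) (hasWeight_laguerreMeasure hα)
    (fun i => measurable_endpointWeight α (b i))
    (fun y => (tendsto_endpointWeight α y).comp hb)
    (fun i => endpointWeight_le α (hbB i).2)
    (fun q => lintegral_eval_rpow_ne_top q (ENNReal.toReal_pos hp0 hp')
      (by norm_num : (0 : ℝ) < 1 / 2) (lintegral_exp_mul_gammaWeight_ne_top hα one_pos))
    (fun _ _ => 1) (fun i k => rfl) (fun i k => ?_) (natDegree_laguerrePoly_le α) (fun k j => ?_)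
    (σ := -1) (by simp) (fun k y => (tendsto_endpoint_factor α k y).comp hb) (fun i c => ?_)
  · refine (natDegree_C_mul_le _ _).trans (natDegree_comp_le.trans ?_)
    calc _ ≤ k * 1 := Nat.mul_le_mul (natDegree_jacobiPoly_le _ _ k)
          ((natDegree_add_le _ _).trans (by
            rw [natDegree_C]; exact max_le zero_le_one ((natDegree_C_mul_le _ _).trans natDegree_X_le)))
      _ = k := mul_one k
  · rw [coeff_laguerrePoly]
    refine ((tendsto_jacobiCoeff_laguerreCoeff α k j).comp hb).congr fun i => ?_
    -- At `x = 1 - 2y/β` the expansion variable `(x-1)/2` is `-y/β`, so rescaling multiplies the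
    -- coefficient `j` by `(-1/β)^j`, and no renormalization is needed.
    have h1 : (C (1 / 2) * (X - 1) : ℝ[X]).comp (C 1 + C (-(2 / b i)) * X)
        = C (-(1 / b i)) * X := by
      simp only [mul_comp, sub_comp, C_comp, X_comp, one_comp, C_1, add_sub_cancel_left]
      rw [← mul_assoc, ← C_mul]
      congr 2
      ring
    rw [C_1, one_mul, ← C_1, jacobiPoly, comp_assoc, h1, comp_C_mul_X_coeff, coeff_jacobiShift]
    rfl
  · have h1 := (hbB i).1
    rw [hR] at h1
    exact (rieszSystem_jacobi hα (hbB i).2.le).eLpNorm_rieszComb_le hp' h1 c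

theorem theorem2p2 (p : ℝ≥0∞) (hp₁ : 1 < p) (hp₂ : p < ∞) (C : ℝ) :
    ((∃ᶠ l : ℝ in atTop, BoundedOnLp (jacobiMeasure (l - 1 / 2) (l - 1 / 2))
          (IsJacobiRiesz (l - 1 / 2) (l - 1 / 2)) p C) →
        BoundedOnLp hermiteMeasure IsGaussianRiesz p C) ∧
    (∀ α : ℝ, -1 < α →
      (∃ᶠ β : ℝ in atTop, BoundedOnLp (jacobiMeasure α β) (IsJacobiRiesz α β) p C) →
        BoundedOnLp (laguerreMeasure α) (IsLaguerreRiesz α) p C) :=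
  ⟨boundedOnLp_gaussianRiesz hp₁.le hp₂.ne,
    fun _ hα => boundedOnLp_laguerreRiesz hp₁.le hp₂.ne hα⟩
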